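/- \textbf{Conventions.} Manifolds are finite-dimensional, real, smooth and without boundary, and ``smooth'' means $C^\infty$. A fiber bundle over a manifold $M$ is a smooth, locally trivial bundle whose typical fiber is a manifold. A \emph{strict} homomorphism of bundles over $M$ is a smooth fiber-preserving map covering $\mathrm{id}_M$. A \emph{Lie group bundle} $\bar G$ over $M$ is a fiber bundle over $M$ whose typical fiber is a Lie group $G$, with a strict homomorphism $\bar G\times_M\bar G\to\bar G$ (product), a smooth global section $1$ (unit) and a strict homomorphism $\bar G\to\bar G$ (inversion) that make each fiber a Lie group, and such that around each point of $M$ there is a smooth local trivialization restricting on each fiber to a group isomorphism onto $G$. An \emph{action} of $\bar G$ on a fiber bundle $E$ over $M$ with typical fiber $E_0$ is a strict homomorphism $\bar G\times_M E\to E$ which restricts, over each $m\in M$, to a group action of $\bar G_m$ on $E_m$, and which is locally constant along $M$: there is a smooth action of $G$ on $E_0$ such that around each point of $M$ there are smooth local trivializations of $\bar G$ (by group isomorphisms) and of $E$ which carry the action of $\bar G_m$ on $E_m$ to the action of $G$ on $E_0$ for all $m$ in their common domain. For $r\ge 1$, the fiber of $J^rE$ over $m$ is the set of $r$-jets $j^r_m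 s$ at $m$ of local sections $s$ of $E$, smooth near $m$: two local sections have the same $r$-jet at $m$ if they have the same value at $m$ and the same derivatives at $m$ up to order $r$ in local coordinates. The manifold structure on $J^rE$ is the one for which the jet coordinates are smooth charts; these are the coordinates sending $j^r_m s$ to the coordinates of $m$ together with the derivatives at $m$, of order $0$ to $r$, of the coordinate expression of $s$, where coordinates are taken from a chart of $M$, a smooth local trivialization of $E$ and a chart of $E_0$. \textbf{Theorem.} Let $\bar G$ be a Lie group bundle over $M$ acting on a fiber bundle $E$ over $M$, and let $r\ge1$. Then $J^r\bar G$ and $J^rE$, with these manifold structures, are fiber bundles over $M$ whose typical fibers are Hausdorff (second countable) if those of $\bar G$ and $E$, respectively, are so; $J^r\bar G$ is a Lie group bundle over $M$ with the product \[ (j^r_m g)\,(j^r_m h)=j^r_m(gh), \] and \[ (j^r_m g)\cdot(j^r_m s)=j^r_m(g\cdot s) \] is (well defined and) an action of the Lie group bundle $J^r\bar G$ on the fiber bundle $J^rE$. Here $g,h$ are local sections of $\bar G$ and $s$ is a local section of $E$ around $m$, and $(gh)(x)=g(x)h(x)$ and $(g\cdot s)(x)=g(x)\cdot s(x)$ are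 again local sections around $m$. -/

import Mathlib

open Bundle Set Filter
open scoped Manifold ContDiff Topology

universe uH uM uW uG u𝒢 uV uF uE

noncomputable section

namespace BundleJets

section FiberBundles

variable {M : Type*} [TopologicalSpace M]
  (H : Type*) [NormedAddCommGroup H] [NormedSpace ℝ H] [ChartedSpace H M]
  (V : Type*) [NormedAddCommGroup V] [NormedSpace ℝ V]
  (F : Type*) [TopologicalSpace F] [ChartedSpace V F]
  (E : M → Type*) [TopologicalSpace (TotalSpace F E)] [∀ x, TopologicalSpace (E x)]
  [FiberBundle F E]

/-- The total space of a fiber bundle over a manifold `M`, with typical fiber a manifold `F`, is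
charted by local trivializations of the bundle followed by charts of `M × F`. -/
instance instChartedSpaceTotalSpace : ChartedSpace (ModelProd H V) (TotalSpace F E) :=
  ChartedSpace.comp (ModelProd H V) (M × F) (TotalSpace F E)

/-- Smooth fiber bundles over the manifold `M` (modelled on `H`), with typical fiber the manifold
`F` (modelled on `V`): the transition maps `(x, v) ↦ (x, τ (x, v))` between the local
trivializations of the bundle atlas are smooth. -/
structure IsSmoothFiberBundle : Prop where
  isManifold_fiber : IsManifold 𝓘(ℝ, V) ∞ F
  contMDiffOn_transition : ∀ (e e' : Trivialization F (π F E)) [MemTrivializationAtlas e]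
    [MemTrivializationAtlas e'],
    ContMDiffOn (𝓘(ℝ, H).prod 𝓘(ℝ, V)) (𝓘(ℝ, H).prod 𝓘(ℝ, V)) ∞
      (e.toOpenPartialHomeomorph.symm.trans e'.toOpenPartialHomeomorph)
      (e.toOpenPartialHomeomorph.symm.trans e'.toOpenPartialHomeomorph).source

variable {F E} in
/-- A smooth local trivialization: a fiber preserving diffeomorphism from the part of the total
space over `e.baseSet` onto `e.baseSet × F`. -/
def IsSmoothTrivialization (e : Trivialization F (π F E)) : Prop :=
  ContMDiffOn (𝓘(ℝ, H).prod 𝓘(ℝ, V)) (𝓘(ℝ, H).prod 𝓘(ℝ, V)) ∞ e e.source ∧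
  ContMDiffOn (𝓘(ℝ, H).prod 𝓘(ℝ, V)) (𝓘(ℝ, H).prod 𝓘(ℝ, V)) ∞
    e.toOpenPartialHomeomorph.symm e.target

end FiberBundles

section FiberProducts

variable {M : Type*} [TopologicalSpace M]
  (H : Type*) [NormedAddCommGroup H] [NormedSpace ℝ H] [ChartedSpace H M]
  (V₁ : Type*) [NormedAddCommGroup V₁] [NormedSpace ℝ V₁]
  (F₁ : Type*) [TopologicalSpace F₁] [ChartedSpace V₁ F₁]
  {E₁ : M → Type*} [TopologicalSpace (TotalSpace F₁ E₁)] [∀ x, TopologicalSpace (E₁ x)]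
  [FiberBundle F₁ E₁]
  (V₂ : Type*) [NormedAddCommGroup V₂] [NormedSpace ℝ V₂]
  (F₂ : Type*) [TopologicalSpace F₂] [ChartedSpace V₂ F₂]
  {E₂ : M → Type*} [TopologicalSpace (TotalSpace F₂ E₂)] [∀ x, TopologicalSpace (E₂ x)]
  [FiberBundle F₂ E₂]
  (V₃ : Type*) [NormedAddCommGroup V₃] [NormedSpace ℝ V₃]
  (F₃ : Type*) [TopologicalSpace F₃] [ChartedSpace V₃ F₃]
  {E₃ : M → Type*} [TopologicalSpace (TotalSpace F₃ E₃)] [∀ x, TopologicalSpace (E₃ x)]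
  [FiberBundle F₃ E₃]

/-- A family of maps `E₁ x × E₂ x → E₃ x` is a strict (over the identity of `M`) smooth bundle
homomorphism `E₁ ×_M E₂ → E₃`: in local trivializations of the three bundles it is given by a
smooth map `(x, a, b) ↦ φ (x, a, b)`. -/
def IsSmoothHomFiberProd (f : ∀ x, E₁ x → E₂ x → E₃ x) : Prop :=
  ∀ (e₁ : Trivialization F₁ (π F₁ E₁)) (e₂ : Trivialization F₂ (π F₂ E₂))
    (e₃ : Trivialization F₃ (π F₃ E₃))
    [MemTrivializationAtlas e₁] [MemTrivializationAtlas e₂] [MemTrivializationAtlas e₃],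
    ∃ φ : M × F₁ × F₂ → F₃,
      ContMDiffOn (𝓘(ℝ, H).prod (𝓘(ℝ, V₁).prod 𝓘(ℝ, V₂))) 𝓘(ℝ, V₃) ∞ φ
        ((e₁.baseSet ∩ e₂.baseSet ∩ e₃.baseSet) ×ˢ univ) ∧
      ∀ x ∈ e₁.baseSet ∩ e₂.baseSet ∩ e₃.baseSet, ∀ (a : E₁ x) (b : E₂ x),
        (e₃ ⟨x, f x a b⟩).2 = φ (x, (e₁ ⟨x, a⟩).2, (e₂ ⟨x, b⟩).2)

end FiberProducts

section LieGroupBundles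

variable {M : Type*} [TopologicalSpace M]
  (H : Type*) [NormedAddCommGroup H] [NormedSpace ℝ H] [ChartedSpace H M]
  (W : Type*) [NormedAddCommGroup W] [NormedSpace ℝ W]
  (G : Type*) [TopologicalSpace G] [ChartedSpace W G] [Group G]
  (𝒢 : M → Type*) [TopologicalSpace (TotalSpace G 𝒢)] [∀ x, TopologicalSpace (𝒢 x)]
  [FiberBundle G 𝒢] [∀ x, Group (𝒢 x)]

variable {G 𝒢} in
/-- A local trivialization that is smooth and restricts to a group isomorphism from each fiber
over its domain onto `G`. -/
def IsGroupTrivialization (e : Trivialization G (π G 𝒢)) : Prop :=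
  IsSmoothTrivialization H W e ∧
  ∀ x ∈ e.baseSet, ∀ a b : 𝒢 x, (e ⟨x, a * b⟩).2 = (e ⟨x, a⟩).2 * (e ⟨x, b⟩).2

/-- Lie group bundles: a smooth fiber bundle whose typical fiber is a Lie group `G`, with a group
structure on each fiber such that product, unit and inversion are smooth over `M`, and such that
the Lie group structure of the fibers is locally constant along `M`, i.e. compatible local
trivializations exist around every point. -/
structure IsLieGroupBundle : Prop where
  isSmoothFiberBundle : IsSmoothFiberBundle H W G 𝒢
  lieGroup : LieGroup 𝓘(ℝ, W) ∞ G
  smooth_mul : IsSmoothHomFiberProd H W G W G W G (fun (x : M) (a b : 𝒢 x) => a * b)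
  smooth_one : ContMDiff 𝓘(ℝ, H) (𝓘(ℝ, H).prod 𝓘(ℝ, W)) ∞
    (fun x : M => (⟨x, 1⟩ : TotalSpace G 𝒢))
  smooth_inv : ContMDiff (𝓘(ℝ, H).prod 𝓘(ℝ, W)) (𝓘(ℝ, H).prod 𝓘(ℝ, W)) ∞
    (fun p : TotalSpace G 𝒢 => (⟨p.proj, p.2⁻¹⟩ : TotalSpace G 𝒢))
  locallyConstant : ∀ x : M, ∃ e : Trivialization G (π G 𝒢),
    x ∈ e.baseSet ∧ IsGroupTrivialization H W e

variable (V : Type*) [NormedAddCommGroup V] [NormedSpace ℝ V]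
  (F : Type*) [TopologicalSpace F] [ChartedSpace V F]
  (E : M → Type*) [TopologicalSpace (TotalSpace F E)] [∀ x, TopologicalSpace (E x)]
  [FiberBundle F E] [∀ x, MulAction (𝒢 x) (E x)]

/-- Actions of a Lie group bundle `𝒢` on a fiber bundle `E` over the same base: each fiber of `𝒢`
acts on the corresponding fiber of `E` (the `MulAction` argument), the action is a smooth strict
bundle homomorphism `𝒢 ×_M E → E`, and it is locally constant along `M`: there is a smooth action
of the typical fiber `G` on the typical fiber `F` to which the actions of the fibers correspond
under suitable local trivializations of `𝒢` and of `E` around every point. -/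
structure IsLieGroupBundleAction : Prop where
  smooth_smul : IsSmoothHomFiberProd H W G V F V F (fun (x : M) (g : 𝒢 x) (v : E x) => g • v)
  locallyConstant : ∃ _ : MulAction G F, ContMDiffSMul 𝓘(ℝ, W) 𝓘(ℝ, V) ∞ G F ∧
    ∀ x : M, ∃ (e : Trivialization G (π G 𝒢)) (e' : Trivialization F (π F E)),
      x ∈ e.baseSet ∩ e'.baseSet ∧ IsGroupTrivialization H W e ∧ IsSmoothTrivialization H V e' ∧
      ∀ y ∈ e.baseSet ∩ e'.baseSet, ∀ (g : 𝒢 y) (v : E y),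
        (e' ⟨y, g • v⟩).2 = (e ⟨y, g⟩).2 • (e' ⟨y, v⟩).2

end LieGroupBundles

section Jets

variable {M : Type*} [TopologicalSpace M]
  (H : Type*) [NormedAddCommGroup H] [NormedSpace ℝ H] [ChartedSpace H M]
  (V : Type*) [NormedAddCommGroup V] [NormedSpace ℝ V]
  (F : Type*) [TopologicalSpace F] [ChartedSpace V F]
  (E : M → Type*) [TopologicalSpace (TotalSpace F E)] [∀ x, TopologicalSpace (E x)]
  [FiberBundle F E]

/-- Local sections of `E` around `x`: sections that are smooth on some neighborhood of `x` (the
values away from that neighborhood are irrelevant). -/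
def LocalSection (x : M) : Type _ :=
  {s : ∀ y, E y // ∀ᶠ y in 𝓝 x,
    ContMDiffAt 𝓘(ℝ, H) (𝓘(ℝ, H).prod 𝓘(ℝ, V)) ∞ (fun z => (⟨z, s z⟩ : TotalSpace F E)) y}

/-- Two local sections around `x` have the same `r`-jet at `x`: they agree at `x`, and so do their
derivatives up to order `r`, computed in a chart of `M` around `x` and a bundle chart of `E` around
the common value. -/
def jetSetoid (r : ℕ) (x : M) : Setoid (LocalSection H V F E x) where
  r s t := s.1 x = t.1 x ∧ ∀ k ≤ r,
    iteratedFDeriv ℝ k (writtenInExtChartAt 𝓘(ℝ, H) (𝓘(ℝ, H).prod 𝓘(ℝ, V)) x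
      (fun z => (⟨z, s.1 z⟩ : TotalSpace F E))) (extChartAt 𝓘(ℝ, H) x x) =
    iteratedFDeriv ℝ k (writtenInExtChartAt 𝓘(ℝ, H) (𝓘(ℝ, H).prod 𝓘(ℝ, V)) x
      (fun z => (⟨z, t.1 z⟩ : TotalSpace F E))) (extChartAt 𝓘(ℝ, H) x x)
  iseqv :=
    { refl := fun _ => ⟨rfl, fun _ _ => rfl⟩
      symm := fun h => ⟨h.1.symm, fun k hk => (h.2 k hk).symm⟩
      trans := fun h h' => ⟨h.1.trans h'.1, fun k hk => (h.2 k hk).trans (h'.2 k hk)⟩ }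

/-- The fiber over `x` of the jet bundle `J^r E → M`: the `r`-jets at `x` of local sections. -/
def JetFiber (r : ℕ) (x : M) : Type _ := Quotient (jetSetoid H V F E r x)

variable {H V F E} in
/-- The `r`-jet at `x` of a local section around `x`. -/
def jet (r : ℕ) {x : M} (s : LocalSection H V F E x) : JetFiber H V F E r x :=
  Quotient.mk (jetSetoid H V F E r x) s

end Jets

/-- The vector space `⨁_{k ≤ r} Sym^k (H; V)` of Taylor coefficients up to order `r`: tuples of
symmetric `k`-linear maps from `H` to `V`. The jet bundle is modelled on `H × JetModel r H V`. -/
def JetModel (r : ℕ) (H V : Type*) [NormedAddCommGroup H] [NormedSpace ℝ H]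
    [NormedAddCommGroup V] [NormedSpace ℝ V] :
    Submodule ℝ (∀ k : Fin (r + 1), H [×(k : ℕ)]→L[ℝ] V) where
  carrier := {a | ∀ (k : Fin (r + 1)) (σ : Equiv.Perm (Fin k)) (v : Fin k → H),
    a k (fun i => v (σ i)) = a k v}
  zero_mem' := fun _ _ _ => rfl
  add_mem' := fun {a b} ha hb k σ v => by
    simp only [Pi.add_apply, add_apply]
    rw [ha k σ v, hb k σ v]
  smul_mem' := fun c a ha k σ v => by
    simp only [Pi.smul_apply, smul_apply]
    rw [ha k σ v]

section JetBundles

variable {M : Type*} [TopologicalSpace M]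
  (H : Type*) [NormedAddCommGroup H] [NormedSpace ℝ H] [ChartedSpace H M]
  (V : Type*) [NormedAddCommGroup V] [NormedSpace ℝ V]
  (F : Type*) [TopologicalSpace F] [ChartedSpace V F]
  (E : M → Type*) [TopologicalSpace (TotalSpace F E)] [∀ x, TopologicalSpace (E x)]
  [FiberBundle F E] (r : ℕ)
  (JF : Type*) [TopologicalSpace JF] [ChartedSpace (JetModel r H V) JF]
  [TopologicalSpace (TotalSpace JF (JetFiber H V F E r))]
  [∀ x, TopologicalSpace (JetFiber H V F E r x)]
  [FiberBundle JF (JetFiber H V F E r)]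

/-- The given topologies and fiber bundle structure (with typical fiber `JF`) on the set of
`r`-jets of local sections of `E` are those of the smooth jet bundle `J^r E → M`: it is a smooth
fiber bundle, and the usual jet coordinates are smooth charts of its total space. The latter
determines topology and smooth structure of the total space uniquely: the jet coordinates belonging
to a chart `φ` of `M`, a local trivialization `e` of `E` and a chart `ψ` of `F` are defined on the
jets at points `x` of the domains of `φ` and `e` of sections `s` with `s x` in the domain of
`ψ ∘ pr₂ ∘ e`; they send the jet of `s` at `x` to `φ x` together with the derivatives at `φ x`, of
order at most `r`, of the local representative `ψ ∘ pr₂ ∘ e ∘ s ∘ φ⁻¹` of `s`. The last two fields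
make `J^r E` Hausdorff and second countable when `M` and `F` are. -/
structure IsJetBundle : Prop where
  isSmoothFiberBundle : IsSmoothFiberBundle H (JetModel r H V) JF (JetFiber H V F E r)
  jetChart : ∀ φ ∈ IsManifold.maximalAtlas 𝓘(ℝ, H) ∞ M,
    ∀ e : Trivialization F (π F E), IsSmoothTrivialization H V e →
    ∀ ψ ∈ IsManifold.maximalAtlas 𝓘(ℝ, V) ∞ F,
    ∃ c ∈ IsManifold.maximalAtlas (𝓘(ℝ, H).prod 𝓘(ℝ, JetModel r H V)) ∞
      (TotalSpace JF (JetFiber H V F E r)),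
      ∀ (x : M) (s : LocalSection H V F E x),
        ((⟨x, jet r s⟩ : TotalSpace JF (JetFiber H V F E r)) ∈ c.source ↔
          x ∈ φ.source ∧ x ∈ e.baseSet ∧ (e ⟨x, s.1 x⟩).2 ∈ ψ.source) ∧
        ((⟨x, jet r s⟩ : TotalSpace JF (JetFiber H V F E r)) ∈ c.source →
          (c ⟨x, jet r s⟩).1 = φ x ∧
          ∀ k : Fin (r + 1), (c ⟨x, jet r s⟩).2.1 k =
            iteratedFDeriv ℝ k (fun h => ψ (e ⟨φ.symm h, s.1 (φ.symm h)⟩).2) (φ x))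
  t2Space_fiber : T2Space F → T2Space JF
  secondCountable_fiber : SecondCountableTopology F → SecondCountableTopology JF

end JetBundles

end BundleJets

end

open BundleJets

/-! The typical fiber of `J^r E` is the manifold `PointJet r H V F` of `r`-jets at the origin of
maps from the model space `H` to `F`. A chart `φ` of `M` and a smooth trivialization `e` of `E` turn
a section `s` near `x` into `h ↦ (e (s (φ⁻¹ (φ x + h)))).2`. Translating by `φ x` moves every base
point to the origin, so all fibers are compared with one and the same space of jets, and `x` enters
only as a parameter.

A chart `ψ` of `F` gives coordinates on `PointJet`: the derivatives at `0` of `ψ ∘ f`, with inverse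
the Taylor polynomial followed by `ψ⁻¹`. Two lemmas then carry all smoothness claims: a smooth
family of maps has a smooth family of jets (`PointJet.smoothNear_jetMk`), and jets locally have
representatives depending smoothly on the jet (`PointJet.exists_smooth_rep`). Hence an operation on
jets induced by a smooth operation on maps is smooth. This covers the coordinate changes of `J^r E`
(`contMDiffAt_jetPretrivialization_change`) as well as the product, inversion and action on
`PointJet` spaces.

Well-definedness on jets is the chain rule: derivatives up to order `r` of a composite involve only
derivatives up to order `r` of its factors (`JetEq.comp_left`, `JetEq.comp_right`). Algebraic axioms
hold pointwise on representatives. Local constancy is inherited: if `e` is multiplicative on every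
fiber over its domain, the induced trivialization carries products of jets of sections to products
in the single Lie group `PointJet r H W G`, and likewise for actions. -/

set_option maxSynthPendingDepth 3

noncomputable section

namespace BundleJets

/-! ### Calculus in normed spaces: symmetry of derivatives, Taylor polynomials, jets of composites.
-/

section VectorSpaces

variable {H : Type*} [NormedAddCommGroup H] [NormedSpace ℝ H]
  {V : Type*} [NormedAddCommGroup V] [NormedSpace ℝ V]
  {V' : Type*} [NormedAddCommGroup V'] [NormedSpace ℝ V']
  {P : Type*} [NormedAddCommGroup P] [NormedSpace ℝ P] {r : ℕ}

/-- The two outermost differentiations form a second derivative of the `n`-th derivative, so this is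
Schwarz's theorem for that function. -/
theorem iteratedFDeriv_comp_swap_zero_one {f : H → V} {x : H} {n : ℕ}
    (hf : ContDiffAt ℝ (n + 2 : ℕ) f x) (v : Fin (n + 2) → H) :
    iteratedFDeriv ℝ (n + 2) f x (v ∘ Equiv.swap 0 1) = iteratedFDeriv ℝ (n + 2) f x v := by
  have h2 : ContDiffAt ℝ 2 (iteratedFDeriv ℝ n f) x :=
    hf.iteratedFDeriv_right (by norm_cast; omega)
  have hsymm := h2.isSymmSndFDerivAt (by simp)
  have key : ∀ w : Fin (n + 2) → H, iteratedFDeriv ℝ (n + 2) f x w =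
      fderiv ℝ (fderiv ℝ (iteratedFDeriv ℝ n f)) x (w 0) (w 1) (Fin.tail (Fin.tail w)) := by
    intro w
    rw [iteratedFDeriv_succ_apply_left, iteratedFDeriv_succ_eq_comp_left,
      LinearIsometryEquiv.comp_fderiv]
    rfl
  rw [key, key, hsymm]
  have : Fin.tail (Fin.tail (v ∘ Equiv.swap 0 1)) = Fin.tail (Fin.tail v) := by
    ext i
    simp only [Fin.tail, Function.comp_apply]
    rw [Equiv.swap_apply_of_ne_of_ne]
    · exact Fin.succ_ne_zero _
    · rw [← Fin.succ_zero_eq_one]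
      exact fun h => Fin.succ_ne_zero _ (Fin.succ_injective _ h)
  rw [this]
  simp

/-- The iterated derivatives of a real `C^n` function are symmetric. -/
theorem iteratedFDeriv_comp_perm_of_contDiffAt {f : H → V} {n : ℕ} {x : H}
    (hf : ContDiffAt ℝ n f x) (σ : Equiv.Perm (Fin n)) (v : Fin n → H) :
    iteratedFDeriv ℝ n f x (v ∘ σ) = iteratedFDeriv ℝ n f x v := by
  induction n generalizing x with
  | zero => congr 1; exact Subsingleton.elim _ _
  | succ n ih =>
    -- Adjacent transpositions generate the symmetric group. The one exchanging the first two slots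
    -- is a second-derivative symmetry; the others act on the tail and come from the induction
    -- hypothesis.
    have hσ : σ ∈ Submonoid.closure
        (Set.range fun i : Fin n => Equiv.swap i.castSucc i.succ) := by
      rw [Equiv.Perm.mclosure_swap_castSucc_succ]; trivial
    induction hσ using Submonoid.closure_induction generalizing v with
    | one => rfl
    | mul a b _ _ ha hb =>
      have : v ∘ ⇑(a * b) = (v ∘ a) ∘ b := rfl
      rw [this, hb, ha]
    | mem a ha =>
      obtain ⟨i, rfl⟩ := ha
      rcases n with _ | n
      · exact i.elim0
      refine Fin.cases ?_ (fun j => ?_) i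
      · exact iteratedFDeriv_comp_swap_zero_one hf v
      -- The induction hypothesis is an identity of functions of the base point. It is to be
      -- differentiated once more, so it is needed on a whole neighborhood of `x`.
      · have hev : ∀ᶠ y in 𝓝 x, ContDiffAt ℝ (n + 1 : ℕ) f y :=
          (hf.of_le (by norm_cast; omega)).eventually (by simp)
        have htail : ∀ w : Fin (n + 2) → H,
            Fin.tail (w ∘ Equiv.swap j.succ.castSucc j.succ.succ) =
              Fin.tail w ∘ Equiv.swap j.castSucc j.succ := by
          intro w
          ext k
          simp only [Fin.tail, Function.comp_apply]
          congr 1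
          rw [← Fin.succ_castSucc]
          simp only [Equiv.swap_apply_def, Fin.succ_inj]
          split_ifs <;> rfl
        have hdiff : DifferentiableAt ℝ (iteratedFDeriv ℝ (n + 1) f) x :=
          hf.differentiableAt_iteratedFDeriv (by norm_cast; omega)
        have happ : ∀ (w : Fin (n + 1) → H) (u : H),
            fderiv ℝ (iteratedFDeriv ℝ (n + 1) f) x u w =
              fderiv ℝ (fun y => iteratedFDeriv ℝ (n + 1) f y w) x u := by
          intro w u
          have := (ContinuousMultilinearMap.apply ℝ (fun _ : Fin (n + 1) => H) V
            w).hasFDerivAt.comp x hdiff.hasFDerivAt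
          exact (congrArg (fun L : H →L[ℝ] V => L u) this.fderiv).symm
        rw [iteratedFDeriv_succ_apply_left, iteratedFDeriv_succ_apply_left, htail, happ, happ]
        have h0 : (v ∘ Equiv.swap j.succ.castSucc j.succ.succ) 0 = v 0 := by
          simp only [Function.comp_apply]
          rw [Equiv.swap_apply_of_ne_of_ne]
          · rw [← Fin.succ_castSucc]; exact (Fin.succ_ne_zero _).symm
          · exact (Fin.succ_ne_zero _).symm
        rw [h0]
        congr 1
        apply Filter.EventuallyEq.fderiv_eq
        filter_upwards [hev] with y hy using ih hy _ _

/-- Makes `JetModel` finite-dimensional, so that linear maps out of it are automatically continuous.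
-/
instance finiteDimensional_continuousMultilinearMap [FiniteDimensional ℝ H]
    [FiniteDimensional ℝ V] (k : ℕ) : FiniteDimensional ℝ (H [×k]→L[ℝ] V) :=
  FiniteDimensional.of_injective
    (ContinuousMultilinearMap.toMultilinearMapLinear :
      (H [×k]→L[ℝ] V) →ₗ[ℝ] MultilinearMap ℝ (fun _ : Fin k => H) V)
    ContinuousMultilinearMap.toMultilinearMap_injective

/-- The polynomial map with given Taylor coefficients at the origin. -/
def taylorPoly (a : JetModel r H V) (h : H) : V :=
  ∑ k : Fin (r + 1), ((k : ℕ).factorial : ℝ)⁻¹ • a.1 k (fun _ => h)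

/-- The expression is linear in the coefficients, so it is a map from `H` into continuous linear
maps on `JetModel`. As `JetModel` is finite-dimensional, smoothness of that map can be tested on
each fixed tuple of coefficients. -/
theorem contDiff_taylorPoly [FiniteDimensional ℝ H] [FiniteDimensional ℝ V] :
    ContDiff ℝ ∞ (fun p : JetModel r H V × H => taylorPoly p.1 p.2) := by
  let L : H → (JetModel r H V →L[ℝ] V) := fun h => LinearMap.toContinuousLinearMap
    { toFun := fun a => taylorPoly a h
      map_add' := fun a b => by
        simp [taylorPoly, Finset.sum_add_distrib]
      map_smul' := fun c a => by
        simp only [taylorPoly, RingHom.id_apply, Finset.smul_sum]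
        refine Finset.sum_congr rfl fun k _ => ?_
        rw [smul_comm]; rfl }
  have hL : ContDiff ℝ ∞ L := by
    rw [contDiff_clm_apply_iff]
    intro a
    change ContDiff ℝ ∞ (fun h => taylorPoly a h)
    unfold taylorPoly
    refine ContDiff.sum fun k _ => ContDiff.const_smul _ ?_
    exact (a.1 k).contDiff.comp (contDiff_pi.2 fun _ => contDiff_id)
  exact (hL.comp contDiff_snd).clm_apply contDiff_fst

theorem contDiff_taylorPoly_apply (a : JetModel r H V) : ContDiff ℝ ∞ (taylorPoly a) := by
  unfold taylorPoly
  refine ContDiff.sum fun k _ => ContDiff.const_smul _ ?_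
  exact (a.1 k).contDiff.comp (contDiff_pi.2 fun _ => contDiff_id)

/-- The polynomial is its own power series at `0`, and its `k`-th derivative is the sum of the
`k`-th coefficient over all permutations of the arguments. By the symmetry built into `JetModel` the
`k!` terms agree, which cancels the factor `1 / k!`. -/
theorem iteratedFDeriv_taylorPoly [CompleteSpace V] (a : JetModel r H V) (k : Fin (r + 1)) :
    iteratedFDeriv ℝ k (taylorPoly a) 0 = a.1 k := by
  let q : FormalMultilinearSeries ℝ H V := fun i =>
    if hi : i < r + 1 then ((i.factorial : ℝ)⁻¹) • a.1 ⟨i, hi⟩ else 0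
  have hq : HasFiniteFPowerSeriesOnBall (taylorPoly a) q 0 (r + 1) ⊤ := by
    refine HasFiniteFPowerSeriesOnBall.mk' (fun m hm => dif_neg (by omega)) (by simp) ?_
    intro y _
    rw [Finset.sum_range, zero_add]
    refine Finset.sum_congr rfl fun i _ => ?_
    simp [q, Nat.le_of_lt_succ i.2]
  ext v
  rw [hq.toHasFPowerSeriesOnBall.iteratedFDeriv_eq_sum_of_completeSpace]
  have hk : q k = (((k : ℕ).factorial : ℝ)⁻¹) • a.1 k := by
    simp [q, Nat.le_of_lt_succ k.2]
  rw [hk]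
  have : ∀ σ : Equiv.Perm (Fin k), ((((k : ℕ).factorial : ℝ)⁻¹) • a.1 k) (fun i => v (σ i)) =
      (((k : ℕ).factorial : ℝ)⁻¹) • a.1 k v := fun σ => by
    rw [← a.2 k σ v]; rfl
  rw [Finset.sum_congr rfl fun σ _ => this σ, Finset.sum_const, Finset.card_univ,
    Fintype.card_perm, Fintype.card_fin, ← Nat.cast_smul_eq_nsmul ℝ, smul_smul,
    mul_inv_cancel₀ (by positivity), one_smul]

open Classical in
/-- The tuple of derivatives, up to order `r`, of a smooth map at a point. -/
def derivs (r : ℕ) (f : H → V) (x : H) : JetModel r H V :=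
  if hf : ContDiffAt ℝ ∞ f x then
    ⟨fun k => iteratedFDeriv ℝ k f x, fun k σ v =>
      iteratedFDeriv_comp_perm_of_contDiffAt (hf.of_le (by exact_mod_cast le_top)) σ v⟩
  else 0

theorem derivs_apply {f : H → V} {x : H} (hf : ContDiffAt ℝ ∞ f x) (k : Fin (r + 1)) :
    (derivs r f x).1 k = iteratedFDeriv ℝ k f x := by
  rw [derivs, dif_pos hf]

theorem derivs_eq_iff {f g : H → V} {x : H} (hf : ContDiffAt ℝ ∞ f x)
    (hg : ContDiffAt ℝ ∞ g x) : derivs r f x = derivs r g x ↔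
      ∀ k ≤ r, iteratedFDeriv ℝ k f x = iteratedFDeriv ℝ k g x := by
  constructor
  · intro h k hk
    have := congrArg (fun a : JetModel r H V => a.1 ⟨k, Nat.lt_succ_of_le hk⟩) h
    simpa only [derivs_apply hf, derivs_apply hg] using this
  · intro h
    apply Subtype.ext
    funext k
    rw [derivs_apply hf, derivs_apply hg, h k (Nat.le_of_lt_succ k.2)]

theorem derivs_taylorPoly [CompleteSpace V] (a : JetModel r H V) :
    derivs r (taylorPoly a) 0 = a := by
  apply Subtype.ext
  funext k
  rw [derivs_apply (contDiff_taylorPoly_apply a).contDiffAt, iteratedFDeriv_taylorPoly]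

/-- Smoothness of maps into the space of Taylor coefficients is checked on components. -/
theorem contDiffAt_jetModel [FiniteDimensional ℝ H] [FiniteDimensional ℝ V]
    {g : P → JetModel r H V} {q : P}
    (hg : ∀ k, ContDiffAt ℝ ∞ (fun p => (g p).1 k) q) : ContDiffAt ℝ ∞ g q := by
  -- A linear projection onto the symmetric tuples, continuous by finite dimension, recovers `g`
  -- from its components.
  obtain ⟨T, hT⟩ := (JetModel r H V).subtype.exists_leftInverse_of_injective
    (Submodule.ker_subtype _)
  have h1 : ContDiffAt ℝ ∞ (fun p => (g p).1) q := contDiffAt_pi.2 hg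
  have h2 := (LinearMap.toContinuousLinearMap T).contDiff.contDiffAt.comp q h1
  refine h2.congr_of_eventuallyEq (Eventually.of_forall fun p => ?_)
  exact (LinearMap.congr_fun hT (g p)).symm

/-- The partial derivative is the full `k`-th derivative of `Ψ` at `(p, x)` with every argument
inserted through `H → P × H`. The full derivative is smooth in `p`, and the insertion is a
continuous linear operation. -/
theorem contDiffAt_iteratedFDeriv_partial {Ψ : P × H → V} {q : P} {x : H}
    (hΨ : ContDiffAt ℝ ∞ Ψ (q, x)) (k : ℕ) :
    ContDiffAt ℝ ∞ (fun p => iteratedFDeriv ℝ k (fun h => Ψ (p, h)) x) q := by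
  have h1 : ContDiffAt ℝ ∞ (iteratedFDeriv ℝ k Ψ) (q, x) :=
    hΨ.iteratedFDeriv_right (by exact_mod_cast le_top)
  have h2 : ContDiffAt ℝ ∞ (fun p => iteratedFDeriv ℝ k Ψ (p, x)) q :=
    ContDiffAt.comp q h1 (contDiffAt_id.prodMk contDiffAt_const)
  have h3 := (ContinuousMultilinearMap.compContinuousLinearMapL (F := V)
    (fun _ : Fin k => ContinuousLinearMap.inr ℝ P H)).contDiff.contDiffAt.comp q h2
  refine h3.congr_of_eventuallyEq ?_
  have hev : ∀ᶠ p in 𝓝 q, ContDiffAt ℝ k Ψ (p, x) :=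
    (Continuous.prodMk_left x).continuousAt.eventually
      ((hΨ.of_le (by exact_mod_cast le_top : (k : ℕ∞ω) ≤ ∞)).eventually (by simp))
  filter_upwards [hev] with p hp
  obtain ⟨u, hu, hxu, hcd⟩ : ∃ u, IsOpen u ∧ (p, x) ∈ u ∧ ContDiffOn ℝ k Ψ u := by
    obtain ⟨u, hu, hcd⟩ := hp.contDiffOn (m := k) le_rfl (by simp)
    obtain ⟨v, hvu, hv, hxv⟩ := mem_nhds_iff.1 hu
    exact ⟨v, hv, hxv, hcd.mono hvu⟩
  -- The slice `h ↦ (p, h)` is only affine. Translating `Ψ` by `(p, 0)` reduces to the linear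
  -- inclusion, for which the chain rule has a single term.
  let Φ : P × H → V := fun z => Ψ (z + (p, 0))
  let u' : Set (P × H) := (fun z => z + (p, 0)) ⁻¹' u
  have hu' : IsOpen u' := hu.preimage (continuous_id.add continuous_const)
  have hcd' : ContDiffOn ℝ k Φ u' :=
    hcd.comp (contDiff_id.add contDiff_const).contDiffOn fun z hz => hz
  have hx' : ContinuousLinearMap.inr ℝ P H x ∈ u' := by simpa [u'] using hxu
  have hpre : IsOpen (ContinuousLinearMap.inr ℝ P H ⁻¹' u') :=
    hu'.preimage (ContinuousLinearMap.inr ℝ P H).continuous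
  have := (ContinuousLinearMap.inr ℝ P H).iteratedFDerivWithin_comp_right hcd'
    hu'.uniqueDiffOn hpre.uniqueDiffOn hx' le_rfl
  rw [iteratedFDerivWithin_of_isOpen _ hpre hx', iteratedFDerivWithin_of_isOpen _ hu' hx',
    iteratedFDeriv_comp_add_right] at this
  have e1 : (Φ ∘ (ContinuousLinearMap.inr ℝ P H)) = fun h => Ψ (p, h) := by
    ext h; simp [Φ]
  have e2 : (ContinuousLinearMap.inr ℝ P H) x + (p, 0) = (p, x) := by simp
  rw [e1, e2] at this
  exact this

theorem contDiffAt_derivs_partial [FiniteDimensional ℝ H] [FiniteDimensional ℝ V]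
    {Ψ : P × H → V} {q : P} {x : H}
    (hΨ : ∀ᶠ z in 𝓝 (q, x), ContDiffAt ℝ ∞ Ψ z) :
    ContDiffAt ℝ ∞ (fun p => derivs r (fun h => Ψ (p, h)) x) q := by
  refine contDiffAt_jetModel fun k => ?_
  refine (contDiffAt_iteratedFDeriv_partial hΨ.self_of_nhds k).congr_of_eventuallyEq ?_
  filter_upwards [(Continuous.prodMk_left x).continuousAt.eventually hΨ] with p hp
  exact derivs_apply (hp.comp x (contDiffAt_const.prodMk contDiffAt_id)) k

/-- By Faà di Bruno's formula the `k`-th derivative of a composite is a sum over ordered partitions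
of `k` elements. The inner function is differentiated once per element of a part, and parts have at
most `k ≤ r` elements. -/
theorem iteratedFDeriv_comp_congr_left {g : V → V'} {f₁ f₂ : H → V} {x : H}
    (hg : ContDiffAt ℝ ∞ g (f₁ x)) (hf₁ : ContDiffAt ℝ ∞ f₁ x) (hf₂ : ContDiffAt ℝ ∞ f₂ x)
    (h : ∀ k ≤ r, iteratedFDeriv ℝ k f₁ x = iteratedFDeriv ℝ k f₂ x) :
    ∀ k ≤ r, iteratedFDeriv ℝ k (g ∘ f₁) x = iteratedFDeriv ℝ k (g ∘ f₂) x := by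
  intro k hk
  have h0 : f₁ x = f₂ x := by
    have := congrArg (fun a => a (fun _ => 0)) (h 0 (Nat.zero_le _))
    simpa using this
  have hk' : (k : ℕ∞ω) ≤ ∞ := by exact_mod_cast le_top
  rw [iteratedFDeriv_comp hg hf₁ hk', iteratedFDeriv_comp (h0 ▸ hg) hf₂ hk', h0]
  simp only [FormalMultilinearSeries.taylorComp]
  refine Finset.sum_congr rfl fun c _ => ?_
  simp only [FormalMultilinearSeries.compAlongOrderedFinpartition]
  congr 1
  funext m
  exact h _ ((c.partSize_le m).trans hk)

/-- In the same formula the outer function is differentiated as often as there are parts, hence at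
most `k ≤ r` times. -/
theorem iteratedFDeriv_comp_congr_right {g₁ g₂ : V → V'} {f : H → V} {x : H}
    (hg₁ : ContDiffAt ℝ ∞ g₁ (f x)) (hg₂ : ContDiffAt ℝ ∞ g₂ (f x)) (hf : ContDiffAt ℝ ∞ f x)
    (h : ∀ k ≤ r, iteratedFDeriv ℝ k g₁ (f x) = iteratedFDeriv ℝ k g₂ (f x)) :
    ∀ k ≤ r, iteratedFDeriv ℝ k (g₁ ∘ f) x = iteratedFDeriv ℝ k (g₂ ∘ f) x := by
  intro k hk
  have hk' : (k : ℕ∞ω) ≤ ∞ := by exact_mod_cast le_top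
  rw [iteratedFDeriv_comp hg₁ hf hk', iteratedFDeriv_comp hg₂ hf hk']
  simp only [FormalMultilinearSeries.taylorComp]
  refine Finset.sum_congr rfl fun c _ => ?_
  simp only [FormalMultilinearSeries.compAlongOrderedFinpartition]
  congr 1
  exact h _ (c.length_le.trans hk)

theorem iteratedFDeriv_prodMk_congr {f₁ f₂ : H → V} {g₁ g₂ : H → V'} {x : H}
    (hf₁ : ContDiffAt ℝ ∞ f₁ x) (hf₂ : ContDiffAt ℝ ∞ f₂ x)
    (hg₁ : ContDiffAt ℝ ∞ g₁ x) (hg₂ : ContDiffAt ℝ ∞ g₂ x)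
    (h : ∀ k ≤ r, iteratedFDeriv ℝ k f₁ x = iteratedFDeriv ℝ k f₂ x)
    (h' : ∀ k ≤ r, iteratedFDeriv ℝ k g₁ x = iteratedFDeriv ℝ k g₂ x) :
    ∀ k ≤ r, iteratedFDeriv ℝ k (fun y => (f₁ y, g₁ y)) x =
      iteratedFDeriv ℝ k (fun y => (f₂ y, g₂ y)) x := by
  intro k hk
  have hk' : (k : ℕ∞ω) ≤ ∞ := by exact_mod_cast le_top
  have key : ∀ {f : H → V} {g : H → V'}, ContDiffAt ℝ ∞ f x → ContDiffAt ℝ ∞ g x →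
      iteratedFDeriv ℝ k (fun y => (f y, g y)) x =
        (ContinuousLinearMap.inl ℝ V V').compContinuousMultilinearMap (iteratedFDeriv ℝ k f x) +
        (ContinuousLinearMap.inr ℝ V V').compContinuousMultilinearMap
          (iteratedFDeriv ℝ k g x) := by
    intro f g hf hg
    have : (fun y => (f y, g y)) = (ContinuousLinearMap.inl ℝ V V') ∘ f +
        (ContinuousLinearMap.inr ℝ V V') ∘ g := by
      ext y <;> simp
    rw [this, iteratedFDeriv_add_apply
      (((ContinuousLinearMap.inl ℝ V V').contDiff.contDiffAt.comp x hf).of_le hk')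
      (((ContinuousLinearMap.inr ℝ V V').contDiff.contDiffAt.comp x hg).of_le hk'),
      ContinuousLinearMap.iteratedFDeriv_comp_left _ hf hk',
      ContinuousLinearMap.iteratedFDeriv_comp_left _ hg hk']
  rw [key hf₁ hg₁, key hf₂ hg₂, h k hk, h' k hk]

end VectorSpaces

/-! ### Smoothness near a point and equality of jets for maps between manifolds. -/

section Manifolds

variable {EX : Type*} [NormedAddCommGroup EX] [NormedSpace ℝ EX] {HX : Type*} [TopologicalSpace HX]
  {X : Type*} [TopologicalSpace X] [ChartedSpace HX X]
  {EY : Type*} [NormedAddCommGroup EY] [NormedSpace ℝ EY] {HY : Type*} [TopologicalSpace HY]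
  {Y : Type*} [TopologicalSpace Y] [ChartedSpace HY Y]
  {EZ : Type*} [NormedAddCommGroup EZ] [NormedSpace ℝ EZ] {HZ : Type*} [TopologicalSpace HZ]
  {Z : Type*} [TopologicalSpace Z] [ChartedSpace HZ Z]

/-- A map is smooth on a neighborhood of a point. -/
def SmoothNear (I : ModelWithCorners ℝ EX HX) (J : ModelWithCorners ℝ EY HY) (f : X → Y)
    (x : X) : Prop :=
  ∀ᶠ y in 𝓝 x, ContMDiffAt I J ∞ f y

/-- Two maps between manifolds have the same `r`-jet at a point. -/
def JetEq (I : ModelWithCorners ℝ EX HX) (J : ModelWithCorners ℝ EY HY) (r : ℕ) (f g : X → Y)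
    (x : X) : Prop :=
  f x = g x ∧ ∀ k ≤ r,
    iteratedFDeriv ℝ k (writtenInExtChartAt I J x f) (extChartAt I x x) =
    iteratedFDeriv ℝ k (writtenInExtChartAt I J x g) (extChartAt I x x)

variable {I : ModelWithCorners ℝ EX HX} {J : ModelWithCorners ℝ EY HY}
  {K : ModelWithCorners ℝ EZ HZ} {f g f' g' : X → Y} {x : X} {r : ℕ}

theorem SmoothNear.contMDiffAt (hf : SmoothNear I J f x) : ContMDiffAt I J ∞ f x :=
  hf.self_of_nhds

theorem SmoothNear.continuousAt (hf : SmoothNear I J f x) : ContinuousAt f x :=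
  hf.contMDiffAt.continuousAt

theorem SmoothNear.eventually (hf : SmoothNear I J f x) : ∀ᶠ y in 𝓝 x, SmoothNear I J f y :=
  eventually_eventually_nhds.2 hf

theorem SmoothNear.of_contMDiffOn {s : Set X} (hf : ContMDiffOn I J ∞ f s) (hs : s ∈ 𝓝 x) :
    SmoothNear I J f x := by
  filter_upwards [eventually_mem_nhds_iff.2 hs] with y hy using hf.contMDiffAt hy

theorem SmoothNear.of_contMDiff (hf : ContMDiff I J ∞ f) : SmoothNear I J f x :=
  Eventually.of_forall fun y => hf y

theorem SmoothNear.congr (hf : SmoothNear I J f x) (h : f' =ᶠ[𝓝 x] f) : SmoothNear I J f' x := by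
  filter_upwards [hf, eventually_eventually_nhds.2 h] with y hy hy'
  exact hy.congr_of_eventuallyEq hy'

theorem SmoothNear.comp {Φ : Y → Z} (hΦ : SmoothNear J K Φ (f x)) (hf : SmoothNear I J f x) :
    SmoothNear I K (fun y => Φ (f y)) x := by
  filter_upwards [hf, hf.continuousAt.eventually hΦ] with y hy hy' using hy'.comp y hy

theorem SmoothNear.comp_of_eq {Φ : Y → Z} {y : Y} (hΦ : SmoothNear J K Φ y)
    (hf : SmoothNear I J f x) (hy : f x = y) : SmoothNear I K (fun y => Φ (f y)) x :=
  SmoothNear.comp (hy ▸ hΦ) hf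

theorem SmoothNear.prodMk {g : X → Z} (hf : SmoothNear I J f x) (hg : SmoothNear I K g x) :
    SmoothNear I (J.prod K) (fun y => (f y, g y)) x := by
  filter_upwards [hf, hg] with y hy hy' using hy.prodMk hy'

theorem smoothNear_id : SmoothNear I I (fun y : X => y) x := .of_contMDiff contMDiff_id

theorem smoothNear_const {y : Y} : SmoothNear I J (fun _ => y) x := .of_contMDiff contMDiff_const

theorem smoothNear_fst {p : X × Y} : SmoothNear (I.prod J) I Prod.fst p :=
  .of_contMDiff contMDiff_fst

theorem smoothNear_snd {p : X × Y} : SmoothNear (I.prod J) J Prod.snd p :=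
  .of_contMDiff contMDiff_snd

/-- A map of two variables that is smooth near a point is smooth in the second variable for nearby
values of the first. -/
theorem SmoothNear.curry {Φ : X × Y → Z} {y : Y} (h : SmoothNear (I.prod J) K Φ (x, y)) :
    ∀ᶠ x' in 𝓝 x, SmoothNear J K (fun y' => Φ (x', y')) y := by
  filter_upwards [(Continuous.prodMk_left y).continuousAt.eventually h.eventually] with x' hx'
  exact SmoothNear.comp hx' (smoothNear_const.prodMk smoothNear_id)

theorem SmoothNear.fst {f : X → Y × Z} (hf : SmoothNear I (J.prod K) f x) :
    SmoothNear I J (fun y => (f y).1) x :=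
  smoothNear_fst.comp hf

theorem SmoothNear.snd {f : X → Y × Z} (hf : SmoothNear I (J.prod K) f x) :
    SmoothNear I K (fun y => (f y).2) x :=
  smoothNear_snd.comp hf

theorem JetEq.refl (f : X → Y) (x : X) : JetEq I J r f f x := ⟨rfl, fun _ _ => rfl⟩

theorem JetEq.symm (h : JetEq I J r f g x) : JetEq I J r g f x :=
  ⟨h.1.symm, fun k hk => (h.2 k hk).symm⟩

theorem JetEq.trans {f₁ f₂ f₃ : X → Y} (h : JetEq I J r f₁ f₂ x) (h' : JetEq I J r f₂ f₃ x) :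
    JetEq I J r f₁ f₃ x :=
  ⟨h.1.trans h'.1, fun k hk => (h.2 k hk).trans (h'.2 k hk)⟩

theorem JetEq.of_eventuallyEq [I.Boundaryless] (h : f =ᶠ[𝓝 x] g) : JetEq I J r f g x := by
  refine ⟨h.self_of_nhds, fun k _ => Filter.EventuallyEq.eq_of_nhds
    (Filter.EventuallyEq.iteratedFDeriv ℝ ?_ k)⟩
  have h1 : ContinuousAt (extChartAt I x).symm (extChartAt I x x) :=
    continuousAt_extChartAt_symm x
  have h2 := h1.eventually (by rw [extChartAt_to_inv]; exact h)
  filter_upwards [h2] with y hy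
  simp only [writtenInExtChartAt, Function.comp_apply, hy, h.self_of_nhds]

theorem jetEq_congr [I.Boundaryless] (hf : f' =ᶠ[𝓝 x] f) (hg : g' =ᶠ[𝓝 x] g)
    (h : JetEq I J r f g x) : JetEq I J r f' g' x :=
  ((JetEq.of_eventuallyEq hf).trans h).trans (JetEq.of_eventuallyEq hg).symm

theorem contDiffAt_writtenInExtChartAt [I.Boundaryless] (hf : ContMDiffAt I J ∞ f x) :
    ContDiffAt ℝ ∞ (writtenInExtChartAt I J x f) (extChartAt I x x) := by
  have := (contMDiffAt_iff.1 hf).2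
  rwa [I.range_eq_univ, contDiffWithinAt_univ] at this

theorem writtenInExtChartAt_comp_eventuallyEq [I.Boundaryless] {Φ : Y → Z}
    (hf : ContinuousAt f x) :
    writtenInExtChartAt I K x (Φ ∘ f) =ᶠ[𝓝 (extChartAt I x x)]
      writtenInExtChartAt J K (f x) Φ ∘ writtenInExtChartAt I J x f := by
  have := writtenInExtChartAt_comp (I := I) (I' := J) (I'' := K) (g := Φ)
    hf.continuousWithinAt (s := univ)
  simpa [I.range_eq_univ] using this

theorem writtenInExtChartAt_apply_self : writtenInExtChartAt I J x f (extChartAt I x x) =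
    extChartAt J (f x) (f x) := by
  simp [writtenInExtChartAt]

/-- Near the base point, the chart expression of a composite is the composite of the chart
expressions, so the chain rule in vector spaces applies. -/
theorem JetEq.comp_left [I.Boundaryless] [J.Boundaryless] {Φ : Y → Z}
    (h : JetEq I J r f g x) (hf : ContMDiffAt I J ∞ f x) (hg : ContMDiffAt I J ∞ g x)
    (hΦ : ContMDiffAt J K ∞ Φ (f x)) :
    JetEq I K r (fun y => Φ (f y)) (fun y => Φ (g y)) x := by
  refine ⟨congrArg Φ h.1, fun k hk => ?_⟩
  have h1 := writtenInExtChartAt_comp_eventuallyEq (K := K) (Φ := Φ) (J := J) (I := I)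
    hf.continuousAt
  have h2 := writtenInExtChartAt_comp_eventuallyEq (K := K) (Φ := Φ) (J := J) (I := I)
    hg.continuousAt
  -- As `f` and `g` agree at `x`, both chart expressions of `Φ` are taken in the same chart of `Y`.
  rw [← h.1] at h2
  refine (h1.iteratedFDeriv ℝ k).eq_of_nhds.trans (Eq.trans ?_ (h2.iteratedFDeriv ℝ k).eq_of_nhds.symm)
  refine iteratedFDeriv_comp_congr_left ?_ (contDiffAt_writtenInExtChartAt hf)
    (contDiffAt_writtenInExtChartAt hg) h.2 k hk
  rw [writtenInExtChartAt_apply_self]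
  exact contDiffAt_writtenInExtChartAt hΦ

theorem JetEq.comp_right [I.Boundaryless] [J.Boundaryless] {Φ Ψ : Y → Z}
    (h : JetEq J K r Φ Ψ (f x)) (hf : ContMDiffAt I J ∞ f x) (hΦ : ContMDiffAt J K ∞ Φ (f x))
    (hΨ : ContMDiffAt J K ∞ Ψ (f x)) :
    JetEq I K r (fun y => Φ (f y)) (fun y => Ψ (f y)) x := by
  refine ⟨h.1, fun k hk => ?_⟩
  have h1 := writtenInExtChartAt_comp_eventuallyEq (K := K) (Φ := Φ) (J := J) (I := I)
    hf.continuousAt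
  have h2 := writtenInExtChartAt_comp_eventuallyEq (K := K) (Φ := Ψ) (J := J) (I := I)
    hf.continuousAt
  refine (h1.iteratedFDeriv ℝ k).eq_of_nhds.trans (Eq.trans ?_ (h2.iteratedFDeriv ℝ k).eq_of_nhds.symm)
  refine iteratedFDeriv_comp_congr_right ?_ ?_ (contDiffAt_writtenInExtChartAt hf) ?_ k hk
  · rw [writtenInExtChartAt_apply_self]
    exact contDiffAt_writtenInExtChartAt hΦ
  · rw [writtenInExtChartAt_apply_self]
    exact contDiffAt_writtenInExtChartAt hΨ
  · rw [writtenInExtChartAt_apply_self]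
    exact h.2

theorem JetEq.comp_right_of_eq [I.Boundaryless] [J.Boundaryless] {Φ Ψ : Y → Z} {y : Y}
    (h : JetEq J K r Φ Ψ y) (hf : ContMDiffAt I J ∞ f x) (hΦ : ContMDiffAt J K ∞ Φ y)
    (hΨ : ContMDiffAt J K ∞ Ψ y) (hy : f x = y) :
    JetEq I K r (fun y => Φ (f y)) (fun y => Ψ (f y)) x := by
  subst hy
  exact h.comp_right hf hΦ hΨ

theorem JetEq.prodMk [I.Boundaryless] {u v : X → Z} (h : JetEq I J r f g x)
    (h' : JetEq I K r u v x) (hf : ContMDiffAt I J ∞ f x) (hg : ContMDiffAt I J ∞ g x)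
    (hu : ContMDiffAt I K ∞ u x) (hv : ContMDiffAt I K ∞ v x) :
    JetEq I (J.prod K) r (fun y => (f y, u y)) (fun y => (g y, v y)) x := by
  refine ⟨Prod.ext h.1 h'.1, fun k hk => ?_⟩
  have key : ∀ (f : X → Y) (u : X → Z), writtenInExtChartAt I (J.prod K) x (fun y => (f y, u y)) =
      fun z => (writtenInExtChartAt I J x f z, writtenInExtChartAt I K x u z) := by
    intro f u
    ext z <;> simp [writtenInExtChartAt]
  rw [key, key]
  exact iteratedFDeriv_prodMk_congr (contDiffAt_writtenInExtChartAt hf)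
    (contDiffAt_writtenInExtChartAt hg) (contDiffAt_writtenInExtChartAt hu)
    (contDiffAt_writtenInExtChartAt hv) h.2 h'.2 k hk

end Manifolds

section VectorSpaces

variable {H : Type*} [NormedAddCommGroup H] [NormedSpace ℝ H]
  {V : Type*} [NormedAddCommGroup V] [NormedSpace ℝ V] {r : ℕ}

theorem jetEq_iff_iteratedFDeriv {f g : H → V} {x : H} :
    JetEq 𝓘(ℝ, H) 𝓘(ℝ, V) r f g x ↔
      ∀ k ≤ r, iteratedFDeriv ℝ k f x = iteratedFDeriv ℝ k g x := by
  have h : ∀ f : H → V, writtenInExtChartAt 𝓘(ℝ, H) 𝓘(ℝ, V) x f = f := fun f => by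
    ext; simp [writtenInExtChartAt, chartAt_self_eq]
  simp only [JetEq, h, extChartAt_model_space_eq_id, PartialEquiv.refl_coe, id]
  refine ⟨fun h => h.2, fun h => ⟨?_, h⟩⟩
  simpa using congrArg (fun a => a (fun _ => 0)) (h 0 (Nat.zero_le _))

theorem jetEq_iff_derivs {f g : H → V} {x : H} (hf : ContDiffAt ℝ ∞ f x)
    (hg : ContDiffAt ℝ ∞ g x) :
    JetEq 𝓘(ℝ, H) 𝓘(ℝ, V) r f g x ↔ derivs r f x = derivs r g x := by
  rw [jetEq_iff_iteratedFDeriv, derivs_eq_iff hf hg]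

end VectorSpaces

/-! ### Transfer between product models and the model of a product vector space. -/

section ProductModels

variable {A B : Type*} [NormedAddCommGroup A] [NormedSpace ℝ A] [NormedAddCommGroup B]
  [NormedSpace ℝ B] {EY : Type*} [NormedAddCommGroup EY] [NormedSpace ℝ EY] {HY : Type*}
  [TopologicalSpace HY] {Y : Type*} [TopologicalSpace Y] [ChartedSpace HY Y]
  {J : ModelWithCorners ℝ EY HY}

theorem contMDiffAt_prod_self_iff {f : A × B → Y} {x : A × B} :
    ContMDiffAt (𝓘(ℝ, A).prod 𝓘(ℝ, B)) J ∞ f x ↔ ContMDiffAt 𝓘(ℝ, A × B) J ∞ f x := by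
  rw [modelWithCornersSelf_prod, ← chartedSpaceSelf_prod]

theorem SmoothNear.contDiffAt {f : A → B} {x : A}
    (hf : SmoothNear 𝓘(ℝ, A) 𝓘(ℝ, B) f x) : ContDiffAt ℝ ∞ f x :=
  hf.contMDiffAt.contDiffAt

theorem SmoothNear.of_contDiff {f : A → B} {x : A} (hf : ContDiff ℝ ∞ f) :
    SmoothNear 𝓘(ℝ, A) 𝓘(ℝ, B) f x :=
  .of_contMDiff hf.contMDiff

end ProductModels

section MaximalAtlas

variable {V : Type*} [NormedAddCommGroup V] [NormedSpace ℝ V]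
  {F : Type*} [TopologicalSpace F] [ChartedSpace V F] {ψ : OpenPartialHomeomorph F V}

theorem smoothNear_of_mem_maximalAtlas (hψ : ψ ∈ IsManifold.maximalAtlas 𝓘(ℝ, V) ∞ F) {p : F}
    (hp : p ∈ ψ.source) : SmoothNear 𝓘(ℝ, V) 𝓘(ℝ, V) ψ p :=
  .of_contMDiffOn (contMDiffOn_of_mem_maximalAtlas hψ) (ψ.open_source.mem_nhds hp)

theorem smoothNear_symm_of_mem_maximalAtlas (hψ : ψ ∈ IsManifold.maximalAtlas 𝓘(ℝ, V) ∞ F) {v : V}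
    (hv : v ∈ ψ.target) : SmoothNear 𝓘(ℝ, V) 𝓘(ℝ, V) ψ.symm v :=
  .of_contMDiffOn (contMDiffOn_symm_of_mem_maximalAtlas hψ) (ψ.open_target.mem_nhds hv)

end MaximalAtlas

/-! ### The manifold of jets at the origin of maps from a vector space to a manifold. -/

section PointJets

variable (r : ℕ) (H : Type uH) [NormedAddCommGroup H] [NormedSpace ℝ H]
  (V : Type uV) [NormedAddCommGroup V] [NormedSpace ℝ V]
  (F : Type uF) [TopologicalSpace F] [ChartedSpace V F]

/-- Maps from a vector space to a manifold that are smooth near the origin. -/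
structure LocalMap : Type (max uH uV uF) where
  toFun : H → F
  smoothNear : SmoothNear 𝓘(ℝ, H) 𝓘(ℝ, V) toFun 0

/-- Equality of `r`-jets at the origin. -/
def LocalMap.setoid : Setoid (LocalMap H V F) where
  r f g := JetEq 𝓘(ℝ, H) 𝓘(ℝ, V) r f.toFun g.toFun 0
  iseqv := ⟨fun _ => JetEq.refl _ _, JetEq.symm, JetEq.trans⟩

/-- The `r`-jets at the origin of `H` of smooth maps from `H` to the manifold `F`. -/
def PointJet : Type (max uH uV uF) := Quotient (LocalMap.setoid r H V F)

variable {H V F} in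
/-- The `r`-jet at the origin of a map that is smooth near the origin. -/
def LocalMap.toJet (f : LocalMap H V F) : PointJet r H V F := Quotient.mk (LocalMap.setoid r H V F) f

variable {H F}

open Classical in
/-- The `r`-jet at the origin of a map (of the constant map with the same value if the map is not
smooth near the origin). -/
def jetMk (f : H → F) : PointJet r H V F :=
  if hf : SmoothNear 𝓘(ℝ, H) 𝓘(ℝ, V) f 0 then LocalMap.toJet r ⟨f, hf⟩
  -- This default keeps the value at the origin, so that `val_jetMk` holds for every `f`.
  else LocalMap.toJet r ⟨fun _ => f 0, smoothNear_const⟩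

variable {r V} {f g : H → F}

theorem jetMk_of_smoothNear (hf : SmoothNear 𝓘(ℝ, H) 𝓘(ℝ, V) f 0) :
    jetMk r V f = LocalMap.toJet r ⟨f, hf⟩ := dif_pos hf

theorem jetMk_eq_iff (hf : SmoothNear 𝓘(ℝ, H) 𝓘(ℝ, V) f 0)
    (hg : SmoothNear 𝓘(ℝ, H) 𝓘(ℝ, V) g 0) :
    jetMk r V f = jetMk r V g ↔ JetEq 𝓘(ℝ, H) 𝓘(ℝ, V) r f g 0 := by
  rw [jetMk_of_smoothNear hf, jetMk_of_smoothNear hg]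
  exact Quotient.eq

theorem jetMk_congr (hf : SmoothNear 𝓘(ℝ, H) 𝓘(ℝ, V) f 0) (h : g =ᶠ[𝓝 0] f) :
    jetMk r V g = jetMk r V f :=
  (jetMk_eq_iff (hf.congr h) hf).2 (JetEq.of_eventuallyEq h)

namespace PointJet

variable (j : PointJet r H V F)

theorem exists_rep : ∃ f : H → F, SmoothNear 𝓘(ℝ, H) 𝓘(ℝ, V) f 0 ∧ jetMk r V f = j := by
  induction j using Quotient.ind with
  | _ f => exact ⟨f.toFun, f.smoothNear, jetMk_of_smoothNear f.smoothNear⟩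

/-- A map with a given jet at the origin. -/
def rep : H → F := j.exists_rep.choose

theorem smoothNear_rep : SmoothNear 𝓘(ℝ, H) 𝓘(ℝ, V) j.rep 0 := j.exists_rep.choose_spec.1

theorem jetMk_rep : jetMk r V j.rep = j := j.exists_rep.choose_spec.2

/-- The value at the origin of a jet. -/
def val : F := j.rep 0

theorem jetEq_rep_jetMk (hf : SmoothNear 𝓘(ℝ, H) 𝓘(ℝ, V) f 0) :
    JetEq 𝓘(ℝ, H) 𝓘(ℝ, V) r (jetMk r V f).rep f 0 :=
  (jetMk_eq_iff (smoothNear_rep _) hf).1 (jetMk_rep _)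

@[simp] theorem val_jetMk (f : H → F) : (jetMk r V f).val = f 0 := by
  by_cases hf : SmoothNear 𝓘(ℝ, H) 𝓘(ℝ, V) f 0
  · exact (jetEq_rep_jetMk hf).1
  · have h : jetMk r V f = jetMk r V fun _ : H => f 0 := by
      rw [jetMk_of_smoothNear (f := fun _ : H => f 0) smoothNear_const, jetMk, dif_neg hf]
    rw [h]
    exact (jetEq_rep_jetMk (f := fun _ : H => f 0) smoothNear_const).1

end PointJet

theorem derivs_congr {f g : H → V} {x : H} (hf : ContDiffAt ℝ ∞ f x) (h : g =ᶠ[𝓝 x] f) :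
    derivs r g x = derivs r f x :=
  (derivs_eq_iff (hf.congr_of_eventuallyEq h) hf).2 fun k _ => (h.iteratedFDeriv ℝ k).eq_of_nhds

theorem smoothNear_taylorPoly (a : JetModel r H V) (h : H) :
    SmoothNear 𝓘(ℝ, H) 𝓘(ℝ, V) (taylorPoly a) h :=
  .of_contDiff (contDiff_taylorPoly_apply a)

theorem jetEq_taylorPoly_derivs [CompleteSpace V] {f : H → V} (hf : ContDiffAt ℝ ∞ f 0) :
    JetEq 𝓘(ℝ, H) 𝓘(ℝ, V) r (taylorPoly (derivs r f 0)) f 0 := by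
  rw [jetEq_iff_derivs (contDiff_taylorPoly_apply _).contDiffAt hf, derivs_taylorPoly]

/-- Jet coordinates are defined through a chosen representative; since composition with `ψ` respects
equality of jets, any representative computes them. -/
theorem derivs_chart_rep_jetMk {ψ : OpenPartialHomeomorph F V}
    (hψ : ψ ∈ IsManifold.maximalAtlas 𝓘(ℝ, V) ∞ F) (hf : SmoothNear 𝓘(ℝ, H) 𝓘(ℝ, V) f 0)
    (h0 : f 0 ∈ ψ.source) :
    derivs r (fun h => ψ ((jetMk r V f).rep h)) 0 = derivs r (fun h => ψ (f h)) 0 := by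
  have hrep := PointJet.jetEq_rep_jetMk (r := r) hf
  have hs := smoothNear_of_mem_maximalAtlas hψ h0
  have hs' : SmoothNear 𝓘(ℝ, H) 𝓘(ℝ, V) (fun h => ψ ((jetMk r V f).rep h)) 0 :=
    hs.comp_of_eq (PointJet.smoothNear_rep _) hrep.1
  rw [← jetEq_iff_derivs hs'.contDiffAt (hs.comp hf).contDiffAt]
  refine hrep.comp_left (PointJet.smoothNear_rep _).contMDiffAt hf.contMDiffAt ?_
  rw [hrep.1]
  exact hs.contMDiffAt

variable [FiniteDimensional ℝ H] [FiniteDimensional ℝ V]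

/-- The coordinates on the space of jets at the origin defined by a chart. -/
def PointJet.partialChart (ψ : OpenPartialHomeomorph F V)
    (hψ : ψ ∈ IsManifold.maximalAtlas 𝓘(ℝ, V) ∞ F) :
    PartialEquiv (PointJet r H V F) (JetModel r H V) where
  toFun j := derivs r (fun h => ψ (j.rep h)) 0
  invFun a := jetMk r V fun h => ψ.symm (taylorPoly a h)
  source := {j | j.val ∈ ψ.source}
  target := {a | taylorPoly a 0 ∈ ψ.target}
  map_source' j hj := by
    have : CompleteSpace V := FiniteDimensional.complete ℝ V
    have hs := (smoothNear_of_mem_maximalAtlas hψ hj).comp_of_eq j.smoothNear_rep rfl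
    have := (jetEq_taylorPoly_derivs (r := r) hs.contDiffAt).1
    simp only [mem_ofPred_eq, this]
    exact ψ.map_source hj
  map_target' a ha := by
    simp only [mem_ofPred_eq, val_jetMk]
    exact ψ.map_target ha
  left_inv' j hj := by
    have : CompleteSpace V := FiniteDimensional.complete ℝ V
    have hs := (smoothNear_of_mem_maximalAtlas hψ hj).comp_of_eq j.smoothNear_rep rfl
    -- The Taylor polynomial has the same jet as `ψ ∘ j.rep`; composing both with `ψ.symm` recovers
    -- the jet of `j.rep`.
    have h1 := jetEq_taylorPoly_derivs (r := r) hs.contDiffAt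
    have ht := smoothNear_symm_of_mem_maximalAtlas hψ (ψ.map_source hj)
    have h2 : (fun h => ψ.symm (ψ (j.rep h))) =ᶠ[𝓝 0] j.rep := by
      filter_upwards [j.smoothNear_rep.continuousAt.eventually
        (ψ.open_source.mem_nhds hj)] with h hh using ψ.left_inv hh
    have h3 := (h1.symm.comp_left hs.contMDiffAt (smoothNear_taylorPoly _ _).contMDiffAt
      ht.contMDiffAt).symm.trans (JetEq.of_eventuallyEq h2)
    refine Eq.trans ?_ j.jetMk_rep
    refine (jetMk_eq_iff ?_ j.smoothNear_rep).2 h3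
    exact ht.comp_of_eq (smoothNear_taylorPoly _ _) h1.1
  right_inv' a ha := by
    have : CompleteSpace V := FiniteDimensional.complete ℝ V
    have ht := (smoothNear_symm_of_mem_maximalAtlas hψ ha).comp (smoothNear_taylorPoly a 0)
    rw [derivs_chart_rep_jetMk hψ ht (ψ.map_target ha)]
    refine Eq.trans ?_ (derivs_taylorPoly a)
    refine derivs_congr (smoothNear_taylorPoly _ _).contDiffAt ?_
    filter_upwards [(smoothNear_taylorPoly a 0).continuousAt.eventually
        (ψ.open_target.mem_nhds ha)] with h hh using ψ.right_inv hh

theorem continuous_taylorPoly_zero : Continuous fun a : JetModel r H V => taylorPoly a 0 :=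
  contDiff_taylorPoly.continuous.comp (Continuous.prodMk_left 0)

theorem smoothNear_uncurry_taylorPoly (p : JetModel r H V × H) :
    SmoothNear (𝓘(ℝ, JetModel r H V).prod 𝓘(ℝ, H)) 𝓘(ℝ, V)
      (fun p : JetModel r H V × H => taylorPoly p.1 p.2) p :=
  Eventually.of_forall fun _ => contMDiffAt_prod_self_iff.2
    contDiff_taylorPoly.contDiffAt.contMDiffAt

theorem contDiffAt_derivs_of_smoothNear {P : Type*} [NormedAddCommGroup P] [NormedSpace ℝ P]
    {Ψ : P × H → V} {q : P}
    (hΨ : SmoothNear (𝓘(ℝ, P).prod 𝓘(ℝ, H)) 𝓘(ℝ, V) Ψ (q, 0)) :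
    ContDiffAt ℝ ∞ (fun p => derivs r (fun h => Ψ (p, h)) 0) q :=
  contDiffAt_derivs_partial (hΨ.mono fun _ h => (contMDiffAt_prod_self_iff.1 h).contDiffAt)

namespace PointJet

variable {ψ ψ' : OpenPartialHomeomorph F V} (hψ : ψ ∈ IsManifold.maximalAtlas 𝓘(ℝ, V) ∞ F)
  (hψ' : ψ' ∈ IsManifold.maximalAtlas 𝓘(ℝ, V) ∞ F)

theorem partialChart_trans_source : ((partialChart (r := r) (H := H) ψ hψ).symm.trans
    (partialChart ψ' hψ')).source = (fun a => taylorPoly a 0) ⁻¹' (ψ.symm.trans ψ').source := by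
  ext a
  simp [PartialEquiv.trans_source, partialChart]

/-- The transition sends `a` to the derivatives at `0` of `ψ' ∘ ψ⁻¹ ∘ taylorPoly a`, a family of
maps depending smoothly on `a`. -/
theorem contDiffOn_partialChart_trans : ContDiffOn ℝ ∞
    ((partialChart (r := r) (H := H) ψ hψ).symm.trans (partialChart ψ' hψ'))
    ((partialChart (r := r) (H := H) ψ hψ).symm.trans (partialChart ψ' hψ')).source := by
  rw [partialChart_trans_source]
  rintro a ⟨ha, ha'⟩
  apply ContDiffAt.contDiffWithinAt
  have h1 : SmoothNear (𝓘(ℝ, JetModel r H V).prod 𝓘(ℝ, H)) 𝓘(ℝ, V)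
      (fun p : JetModel r H V × H => ψ' (ψ.symm (taylorPoly p.1 p.2))) (a, 0) :=
    (smoothNear_of_mem_maximalAtlas hψ' ha').comp_of_eq
      ((smoothNear_symm_of_mem_maximalAtlas hψ ha).comp_of_eq
        (smoothNear_uncurry_taylorPoly (a, 0)) rfl) rfl
  refine (contDiffAt_derivs_of_smoothNear h1).congr_of_eventuallyEq ?_
  have hopen : (fun a : JetModel r H V => taylorPoly a 0) ⁻¹' (ψ.symm.trans ψ').source ∈ 𝓝 a :=
    continuous_taylorPoly_zero.continuousAt ((ψ.symm.trans ψ').open_source.mem_nhds ⟨ha, ha'⟩)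
  filter_upwards [hopen] with b hb
  exact derivs_chart_rep_jetMk hψ'
    ((smoothNear_symm_of_mem_maximalAtlas hψ hb.1).comp (smoothNear_taylorPoly b 0)) hb.2

variable [IsManifold 𝓘(ℝ, V) ∞ F]

variable (r H V F) in
/-- The atlas of the space of jets at the origin. -/
def chartedSpaceCore : ChartedSpaceCore (JetModel r H V) (PointJet r H V F) where
  -- All charts in the maximal atlas of `F` are admitted, so the jet coordinates of any smooth chart
  -- belong to the atlas by construction.
  atlas := {e | ∃ ψ, ∃ hψ : ψ ∈ IsManifold.maximalAtlas 𝓘(ℝ, V) ∞ F, e = partialChart ψ hψ}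
  chartAt j := partialChart (chartAt V j.val) (IsManifold.chart_mem_maximalAtlas _)
  mem_chart_source j := mem_chart_source V j.val
  chart_mem_atlas j := ⟨_, _, rfl⟩
  open_source := by
    rintro _ _ ⟨ψ, hψ, rfl⟩ ⟨ψ', hψ', rfl⟩
    rw [partialChart_trans_source]
    exact (ψ.symm.trans ψ').open_source.preimage continuous_taylorPoly_zero
  continuousOn_toFun := by
    rintro _ _ ⟨ψ, hψ, rfl⟩ ⟨ψ', hψ', rfl⟩
    exact (contDiffOn_partialChart_trans hψ hψ').continuousOn

instance topologicalSpace : TopologicalSpace (PointJet r H V F) :=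
  (chartedSpaceCore r H V F).toTopologicalSpace

instance chartedSpace : ChartedSpace (JetModel r H V) (PointJet r H V F) :=
  (chartedSpaceCore r H V F).toChartedSpace

instance isManifold : IsManifold 𝓘(ℝ, JetModel r H V) ∞ (PointJet r H V F) := by
  refine isManifold_of_contDiffOn _ _ _ fun e e' he he' => ?_
  obtain ⟨_, ⟨ψ, hψ, rfl⟩, rfl⟩ := mem_iUnion₂.1 he
  obtain ⟨_, ⟨ψ', hψ', rfl⟩, rfl⟩ := mem_iUnion₂.1 he'
  simp only [modelWithCornersSelf_coe, modelWithCornersSelf_coe_symm, Function.id_comp,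
    Function.comp_id, preimage_id, range_id, inter_univ]
  exact contDiffOn_partialChart_trans (r := r) (H := H) hψ hψ'

/-- The chart on the space of jets at the origin defined by a chart. -/
def chart (ψ : OpenPartialHomeomorph F V) (hψ : ψ ∈ IsManifold.maximalAtlas 𝓘(ℝ, V) ∞ F) :
    OpenPartialHomeomorph (PointJet r H V F) (JetModel r H V) :=
  (chartedSpaceCore r H V F).openPartialHomeomorph (partialChart ψ hψ) ⟨ψ, hψ, rfl⟩

theorem chart_mem_atlas : chart ψ hψ ∈ atlas (JetModel r H V) (PointJet r H V F) :=
  mem_iUnion₂.2 ⟨_, ⟨ψ, hψ, rfl⟩, rfl⟩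

theorem chart_mem_maximalAtlas : chart ψ hψ ∈
    IsManifold.maximalAtlas 𝓘(ℝ, JetModel r H V) ∞ (PointJet r H V F) :=
  IsManifold.subset_maximalAtlas (chart_mem_atlas hψ)

theorem mem_chart_source_iff {j : PointJet r H V F} : j ∈ (chart ψ hψ).source ↔
    j.val ∈ ψ.source := Iff.rfl

theorem chart_symm_apply (a : JetModel r H V) :
    (chart ψ hψ).symm a = jetMk r V fun h => ψ.symm (taylorPoly a h) := rfl

theorem chart_jetMk (hf : SmoothNear 𝓘(ℝ, H) 𝓘(ℝ, V) f 0) (h0 : f 0 ∈ ψ.source) :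
    chart ψ hψ (jetMk r V f) = derivs r (fun h => ψ (f h)) 0 :=
  derivs_chart_rep_jetMk hψ hf h0

/-- In jet coordinates the value is `ψ⁻¹` of the Taylor polynomial at `0`. -/
theorem continuous_val : Continuous (val : PointJet r H V F → F) := by
  rw [continuous_iff_continuousAt]
  intro j
  let ψ := chartAt V j.val
  have hψ : ψ ∈ IsManifold.maximalAtlas 𝓘(ℝ, V) ∞ F := IsManifold.chart_mem_maximalAtlas _
  have hj : j ∈ (chart (r := r) (H := H) ψ hψ).source := mem_chart_source V j.val
  have hj' := (chart (r := r) (H := H) ψ hψ).map_source hj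
  have h1 : ContinuousAt (fun i => ψ.symm (taylorPoly (chart (r := r) (H := H) ψ hψ i) 0)) j :=
    ContinuousAt.comp (f := fun i => taylorPoly (chart (r := r) (H := H) ψ hψ i) 0)
      (ψ.symm.continuousAt hj')
      (continuous_taylorPoly_zero.continuousAt.comp ((chart ψ hψ).continuousAt hj))
  refine h1.congr ?_
  filter_upwards [(chart (r := r) (H := H) ψ hψ).open_source.mem_nhds hj] with i hi
  have := congrArg val ((chart (r := r) (H := H) ψ hψ).left_inv hi)
  rwa [chart_symm_apply, val_jetMk] at this

/-- Jets with different values are separated in `F`. Jets with the same value lie in one common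
chart, since membership in a chart domain depends only on the value. -/
theorem t2Space [T2Space F] : T2Space (PointJet r H V F) := by
  refine ⟨fun i j hij => ?_⟩
  by_cases h : i.val = j.val
  · let ψ := chartAt V i.val
    have hψ : ψ ∈ IsManifold.maximalAtlas 𝓘(ℝ, V) ∞ F := IsManifold.chart_mem_maximalAtlas _
    let c := chart (r := r) (H := H) ψ hψ
    have hi : i ∈ c.source := mem_chart_source V i.val
    have hj : j ∈ c.source := by
      change j.val ∈ ψ.source
      rw [← h]
      exact mem_chart_source V i.val
    obtain ⟨u, v, hu, hv, hiu, hjv, huv⟩ := t2_separation (c.injOn.ne hi hj hij)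
    refine ⟨c.source ∩ c ⁻¹' u, c.source ∩ c ⁻¹' v, c.isOpen_inter_preimage hu,
      c.isOpen_inter_preimage hv, ⟨hi, hiu⟩, ⟨hj, hjv⟩, ?_⟩
    exact (huv.preimage c).mono inter_subset_right inter_subset_right
  · obtain ⟨u, v, hu, hv, hiu, hjv, huv⟩ := t2_separation h
    exact ⟨_, _, hu.preimage continuous_val, hv.preimage continuous_val, hiu, hjv,
      huv.preimage val⟩

/-- Chart domains are preimages of chart domains of `F` under `val`, so countably many charts
covering `F` give countably many covering the jets. -/
theorem secondCountableTopology [SecondCountableTopology F] :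
    SecondCountableTopology (PointJet r H V F) := by
  obtain ⟨s, hs, hs'⟩ := TopologicalSpace.countable_cover_nhds
    (f := fun p : F => (chartAt V p).source) fun p => chart_source_mem_nhds V p
  have := hs.to_subtype
  let c : s → OpenPartialHomeomorph (PointJet r H V F) (JetModel r H V) := fun p =>
    chart (chartAt V (p : F)) (IsManifold.chart_mem_maximalAtlas _)
  have hc : ∀ p, SecondCountableTopology (c p).source := fun p =>
    (c p).secondCountableTopology_source
  refine TopologicalSpace.secondCountableTopology_of_countable_cover
    (U := fun p => (c p).source) (fun p => (c p).open_source) ?_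
  refine eq_univ_of_forall fun j => ?_
  obtain ⟨p, hp, hjp⟩ := mem_iUnion₂.1 (hs'.symm ▸ mem_univ j.val :
    j.val ∈ ⋃ p ∈ s, (chartAt V p).source)
  exact mem_iUnion.2 ⟨⟨p, hp⟩, hjp⟩

/-- Jets depend smoothly on parameters: a smooth family of maps has a smooth family of jets. -/
theorem smoothNear_jetMk {EQ : Type*} [NormedAddCommGroup EQ] [NormedSpace ℝ EQ] {HQ : Type*}
    [TopologicalSpace HQ] {Q : Type*} [TopologicalSpace Q] [ChartedSpace HQ Q]
    {I : ModelWithCorners ℝ EQ HQ} [I.Boundaryless] [IsManifold I ∞ Q] {Ψ : Q × H → F} {q : Q}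
    (hΨ : SmoothNear (I.prod 𝓘(ℝ, H)) 𝓘(ℝ, V) Ψ (q, 0)) :
    SmoothNear I 𝓘(ℝ, JetModel r H V) (fun p => jetMk r V fun h => Ψ (p, h)) q := by
  -- Smoothness near a point is an open condition, so smoothness of the family of jets at single
  -- parameters suffices.
  have key : ∀ q, SmoothNear (I.prod 𝓘(ℝ, H)) 𝓘(ℝ, V) Ψ (q, 0) →
      ContMDiffAt I 𝓘(ℝ, JetModel r H V) ∞ (fun p => jetMk r V fun h => Ψ (p, h)) q := by
    intro q hΨ
    let ψ := chartAt V (Ψ (q, 0))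
    have hψ : ψ ∈ IsManifold.maximalAtlas 𝓘(ℝ, V) ∞ F := IsManifold.chart_mem_maximalAtlas _
    have hq : Ψ (q, 0) ∈ ψ.source := mem_chart_source V _
    have hψΨ : SmoothNear (I.prod 𝓘(ℝ, H)) 𝓘(ℝ, V) (fun p => ψ (Ψ p)) (q, 0) :=
      (smoothNear_of_mem_maximalAtlas hψ hq).comp hΨ
    -- A chart replaces the parameter manifold by a normed space, where the derivatives at `0` are
    -- known to depend smoothly on the parameter.
    let c := extChartAt I q
    have hc : SmoothNear 𝓘(ℝ, EQ) I c.symm (c q) :=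
      .of_contMDiffOn (contMDiffOn_extChartAt_symm q) (extChartAt_target_mem_nhds q)
    have h1 : SmoothNear (𝓘(ℝ, EQ).prod 𝓘(ℝ, H)) 𝓘(ℝ, V)
        (fun p : EQ × H => ψ (Ψ (c.symm p.1, p.2))) (c q, 0) := by
      refine hψΨ.comp_of_eq (f := fun p : EQ × H => (c.symm p.1, p.2))
        (SmoothNear.prodMk (SmoothNear.comp_of_eq hc smoothNear_fst rfl) smoothNear_snd) ?_
      simp [c]
    have h2 : ContMDiffAt I 𝓘(ℝ, JetModel r H V) ∞
        (fun p => derivs r (fun h => ψ (Ψ (c.symm (c p), h))) 0) q :=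
      (contDiffAt_derivs_of_smoothNear h1).contMDiffAt.comp q contMDiffAt_extChartAt
    have hmem : (jetMk r V fun h => Ψ (q, h)) ∈ (chart (r := r) (H := H) ψ hψ).source := by
      change (jetMk r V fun h => Ψ (q, h)).val ∈ ψ.source
      rwa [val_jetMk]
    have h3 : derivs r (fun h => ψ (Ψ (c.symm (c q), h))) 0 =
        chart ψ hψ (jetMk r V fun h => Ψ (q, h)) := by
      rw [chart_jetMk hψ hΨ.curry.self_of_nhds hq]
      simp [c]
    have h4 := (smoothNear_symm_of_mem_maximalAtlas (chart_mem_maximalAtlas (r := r) (H := H) hψ)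
      ((chart ψ hψ).map_source hmem)).contMDiffAt
    rw [← h3] at h4
    refine (h4.comp q h2).congr_of_eventuallyEq ?_
    have h5 : ∀ᶠ p in 𝓝 q, Ψ (p, 0) ∈ ψ.source :=
      (hΨ.continuousAt.comp (f := fun p => (p, (0 : H)))
        (Continuous.prodMk_left 0).continuousAt).eventually (ψ.open_source.mem_nhds hq)
    filter_upwards [hΨ.curry, h5, extChartAt_source_mem_nhds (I := I) q] with p hp hp' hp''
    simp only [Function.comp_apply, c, (extChartAt I q).left_inv hp'']
    rw [← chart_jetMk hψ hp hp', (chart ψ hψ).left_inv]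
    change (jetMk r V fun h => Ψ (p, h)).val ∈ ψ.source
    rwa [val_jetMk]
  filter_upwards [(Continuous.prodMk_left (0 : H)).continuousAt.eventually hΨ.eventually] with p hp
  exact key p hp

/-- Locally, jets are represented by maps that depend smoothly on the jet. -/
theorem exists_smooth_rep (j : PointJet r H V F) : ∃ R : PointJet r H V F × H → F,
    SmoothNear (𝓘(ℝ, JetModel r H V).prod 𝓘(ℝ, H)) 𝓘(ℝ, V) R (j, 0) ∧
    ∀ᶠ i in 𝓝 j, jetMk r V (fun h => R (i, h)) = i := by
  let ψ := chartAt V j.val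
  have hψ : ψ ∈ IsManifold.maximalAtlas 𝓘(ℝ, V) ∞ F := IsManifold.chart_mem_maximalAtlas _
  let c := chart (r := r) (H := H) ψ hψ
  have hj : j ∈ c.source := mem_chart_source V j.val
  -- The Taylor polynomial in the chart `ψ` is a representative depending smoothly on the
  -- coefficients.
  refine ⟨fun p => ψ.symm (taylorPoly (c p.1) p.2), ?_, ?_⟩
  · refine (smoothNear_symm_of_mem_maximalAtlas hψ (c.map_source hj)).comp_of_eq ?_ rfl
    refine (smoothNear_uncurry_taylorPoly (c j, 0)).comp_of_eq
      (f := fun p : PointJet r H V F × H => (c p.1, p.2)) ?_ rfl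
    exact ((smoothNear_of_mem_maximalAtlas (chart_mem_maximalAtlas hψ) hj).comp_of_eq
      smoothNear_fst rfl).prodMk smoothNear_snd
  · filter_upwards [c.open_source.mem_nhds hj] with i hi using c.left_inv hi

end PointJet

end PointJets

namespace PointJet

/-! ### Smooth maps act smoothly on jets at the origin. -/

section Functoriality

variable {r : ℕ} {H : Type*} [NormedAddCommGroup H] [NormedSpace ℝ H]
  {V₁ : Type*} [NormedAddCommGroup V₁] [NormedSpace ℝ V₁]
  {F₁ : Type*} [TopologicalSpace F₁] [ChartedSpace V₁ F₁]
  {V₂ : Type*} [NormedAddCommGroup V₂] [NormedSpace ℝ V₂]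
  {F₂ : Type*} [TopologicalSpace F₂] [ChartedSpace V₂ F₂]
  {V₃ : Type*} [NormedAddCommGroup V₃] [NormedSpace ℝ V₃]
  {F₃ : Type*} [TopologicalSpace F₃] [ChartedSpace V₃ F₃]

/-- The map induced on jets by a smooth map. -/
def map (ν : F₁ → F₂) (j : PointJet r H V₁ F₁) : PointJet r H V₂ F₂ :=
  jetMk r V₂ fun h => ν (j.rep h)

/-- The map induced on jets by a smooth map of two variables. -/
def map₂ (μ : F₁ → F₂ → F₃) (i : PointJet r H V₁ F₁) (j : PointJet r H V₂ F₂) :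
    PointJet r H V₃ F₃ :=
  jetMk r V₃ fun h => μ (i.rep h) (j.rep h)

theorem map_jetMk {ν : F₁ → F₂} (hν : ContMDiff 𝓘(ℝ, V₁) 𝓘(ℝ, V₂) ∞ ν) {f : H → F₁}
    (hf : SmoothNear 𝓘(ℝ, H) 𝓘(ℝ, V₁) f 0) :
    map ν (jetMk r V₁ f) = jetMk r V₂ fun h => ν (f h) :=
  (jetMk_eq_iff ((SmoothNear.of_contMDiff hν).comp (smoothNear_rep _))
    ((SmoothNear.of_contMDiff hν).comp hf)).2
    ((jetEq_rep_jetMk hf).comp_left (smoothNear_rep _).contMDiffAt hf.contMDiffAt (hν _))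

theorem map₂_jetMk {μ : F₁ → F₂ → F₃}
    (hμ : ContMDiff (𝓘(ℝ, V₁).prod 𝓘(ℝ, V₂)) 𝓘(ℝ, V₃) ∞ fun p : F₁ × F₂ => μ p.1 p.2)
    {f : H → F₁} {g : H → F₂} (hf : SmoothNear 𝓘(ℝ, H) 𝓘(ℝ, V₁) f 0)
    (hg : SmoothNear 𝓘(ℝ, H) 𝓘(ℝ, V₂) g 0) :
    map₂ μ (jetMk r V₁ f) (jetMk r V₂ g) = jetMk r V₃ fun h => μ (f h) (g h) := by
  have hf' := smoothNear_rep (jetMk r V₁ f)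
  have hg' := smoothNear_rep (jetMk r V₂ g)
  refine (jetMk_eq_iff
    ((SmoothNear.of_contMDiff hμ).comp (f := fun h => (_, _)) (hf'.prodMk hg'))
    ((SmoothNear.of_contMDiff hμ).comp (f := fun h => (_, _)) (hf.prodMk hg))).2 ?_
  exact ((jetEq_rep_jetMk hf).prodMk (jetEq_rep_jetMk hg) hf'.contMDiffAt hf.contMDiffAt
    hg'.contMDiffAt hg.contMDiffAt).comp_left (hf'.prodMk hg').contMDiffAt
    (hf.prodMk hg).contMDiffAt (hμ _)

variable [FiniteDimensional ℝ H] [FiniteDimensional ℝ V₁] [FiniteDimensional ℝ V₂]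
  [FiniteDimensional ℝ V₃] [IsManifold 𝓘(ℝ, V₁) ∞ F₁] [IsManifold 𝓘(ℝ, V₂) ∞ F₂]
  [IsManifold 𝓘(ℝ, V₃) ∞ F₃]

/-- The representatives chosen in the definition of `map` need not vary smoothly. Near `j` they are
replaced by the smooth family of `exists_smooth_rep`, which leaves the resulting jets unchanged. -/
theorem contMDiff_map {ν : F₁ → F₂} (hν : ContMDiff 𝓘(ℝ, V₁) 𝓘(ℝ, V₂) ∞ ν) :
    ContMDiff 𝓘(ℝ, JetModel r H V₁) 𝓘(ℝ, JetModel r H V₂) ∞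
      (map ν : PointJet r H V₁ F₁ → PointJet r H V₂ F₂) := by
  intro j
  obtain ⟨R, hR, hR'⟩ := exists_smooth_rep j
  refine (smoothNear_jetMk (r := r)
    ((SmoothNear.of_contMDiff hν).comp hR)).contMDiffAt.congr_of_eventuallyEq ?_
  filter_upwards [hR', hR.curry] with i hi hi'
  rw [← map_jetMk hν hi', hi]

theorem contMDiff_map₂ {μ : F₁ → F₂ → F₃}
    (hμ : ContMDiff (𝓘(ℝ, V₁).prod 𝓘(ℝ, V₂)) 𝓘(ℝ, V₃) ∞ fun p : F₁ × F₂ => μ p.1 p.2) :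
    ContMDiff (𝓘(ℝ, JetModel r H V₁).prod 𝓘(ℝ, JetModel r H V₂)) 𝓘(ℝ, JetModel r H V₃) ∞
      (fun p : PointJet r H V₁ F₁ × PointJet r H V₂ F₂ =>
        (map₂ μ p.1 p.2 : PointJet r H V₃ F₃)) := by
  rintro ⟨i, j⟩
  obtain ⟨R, hR, hR'⟩ := exists_smooth_rep i
  obtain ⟨S, hS, hS'⟩ := exists_smooth_rep j
  have h1 : SmoothNear ((𝓘(ℝ, JetModel r H V₁).prod 𝓘(ℝ, JetModel r H V₂)).prod 𝓘(ℝ, H))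
      (𝓘(ℝ, V₁).prod 𝓘(ℝ, V₂))
      (fun p : (PointJet r H V₁ F₁ × PointJet r H V₂ F₂) × H =>
        (R (p.1.1, p.2), S (p.1.2, p.2))) ((i, j), 0) :=
    (hR.comp_of_eq (smoothNear_fst.fst.prodMk smoothNear_snd) rfl).prodMk
      (hS.comp_of_eq (smoothNear_fst.snd.prodMk smoothNear_snd) rfl)
  refine (smoothNear_jetMk (r := r)
    ((SmoothNear.of_contMDiff hμ).comp h1)).contMDiffAt.congr_of_eventuallyEq ?_
  filter_upwards [continuousAt_fst.eventually hR', continuousAt_snd.eventually hS',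
    continuousAt_fst.eventually hR.curry, continuousAt_snd.eventually hS.curry] with p h1 h2 h3 h4
  rw [← map₂_jetMk hμ h3 h4, h1, h2]

end Functoriality

/-! ### Lie groups of jets and their smooth actions. -/

section Groups

variable {r : ℕ} {H : Type*} [NormedAddCommGroup H] [NormedSpace ℝ H]
  {W : Type*} [NormedAddCommGroup W] [NormedSpace ℝ W]
  {G : Type*} [TopologicalSpace G] [ChartedSpace W G] [Group G] [LieGroup 𝓘(ℝ, W) ∞ G]
  {V : Type*} [NormedAddCommGroup V] [NormedSpace ℝ V]
  {F : Type*} [TopologicalSpace F] [ChartedSpace V F]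

instance : Mul (PointJet r H W G) := ⟨map₂ (· * ·)⟩
instance : One (PointJet r H W G) := ⟨jetMk r W fun _ => 1⟩
instance : Inv (PointJet r H W G) := ⟨map (·⁻¹)⟩

theorem jetMk_mul {f g : H → G} (hf : SmoothNear 𝓘(ℝ, H) 𝓘(ℝ, W) f 0)
    (hg : SmoothNear 𝓘(ℝ, H) 𝓘(ℝ, W) g 0) :
    jetMk r W f * jetMk r W g = jetMk r W fun h => f h * g h :=
  map₂_jetMk (contMDiff_mul 𝓘(ℝ, W) ∞) hf hg

theorem jetMk_one : jetMk r W (fun _ => 1) = (1 : PointJet r H W G) := rfl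

theorem jetMk_inv {f : H → G} (hf : SmoothNear 𝓘(ℝ, H) 𝓘(ℝ, W) f 0) :
    (jetMk r W f)⁻¹ = jetMk r W fun h => (f h)⁻¹ :=
  map_jetMk (contMDiff_inv 𝓘(ℝ, W) ∞) hf

theorem smoothNear_mul {f g : H → G} (hf : SmoothNear 𝓘(ℝ, H) 𝓘(ℝ, W) f 0)
    (hg : SmoothNear 𝓘(ℝ, H) 𝓘(ℝ, W) g 0) :
    SmoothNear 𝓘(ℝ, H) 𝓘(ℝ, W) (fun h => f h * g h) 0 :=
  (SmoothNear.of_contMDiff (contMDiff_mul 𝓘(ℝ, W) ∞)).comp (hf.prodMk hg)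

theorem smoothNear_inv {f : H → G} (hf : SmoothNear 𝓘(ℝ, H) 𝓘(ℝ, W) f 0) :
    SmoothNear 𝓘(ℝ, H) 𝓘(ℝ, W) (fun h => (f h)⁻¹) 0 :=
  (SmoothNear.of_contMDiff (contMDiff_inv 𝓘(ℝ, W) ∞)).comp hf

instance group : Group (PointJet r H W G) :=
  Group.ofLeftAxioms
    (fun i j k => by
      obtain ⟨f, hf, rfl⟩ := i.exists_rep
      obtain ⟨g, hg, rfl⟩ := j.exists_rep
      obtain ⟨u, hu, rfl⟩ := k.exists_rep
      rw [jetMk_mul hf hg, jetMk_mul (smoothNear_mul hf hg) hu, jetMk_mul hg hu,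
        jetMk_mul hf (smoothNear_mul hg hu)]
      simp only [mul_assoc])
    (fun i => by
      obtain ⟨f, hf, rfl⟩ := i.exists_rep
      rw [← jetMk_one, jetMk_mul smoothNear_const hf]
      simp only [one_mul])
    (fun i => by
      obtain ⟨f, hf, rfl⟩ := i.exists_rep
      rw [jetMk_inv hf, jetMk_mul (smoothNear_inv hf) hf]
      simp only [inv_mul_cancel]
      rfl)

instance lieGroup [FiniteDimensional ℝ H] [FiniteDimensional ℝ W] :
    LieGroup 𝓘(ℝ, JetModel r H W) ∞ (PointJet r H W G) where
  contMDiff_mul := contMDiff_map₂ (contMDiff_mul 𝓘(ℝ, W) ∞)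
  contMDiff_inv := contMDiff_map (contMDiff_inv 𝓘(ℝ, W) ∞)

variable [MulAction G F] [ContMDiffSMul 𝓘(ℝ, W) 𝓘(ℝ, V) ∞ G F]

instance : SMul (PointJet r H W G) (PointJet r H V F) := ⟨map₂ (· • ·)⟩

theorem jetMk_smul {f : H → G} {g : H → F} (hf : SmoothNear 𝓘(ℝ, H) 𝓘(ℝ, W) f 0)
    (hg : SmoothNear 𝓘(ℝ, H) 𝓘(ℝ, V) g 0) :
    jetMk r W f • jetMk r V g = jetMk r V fun h => f h • g h :=
  map₂_jetMk ContMDiffSMul.contMDiff_smul hf hg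

theorem smoothNear_smul {f : H → G} {g : H → F} (hf : SmoothNear 𝓘(ℝ, H) 𝓘(ℝ, W) f 0)
    (hg : SmoothNear 𝓘(ℝ, H) 𝓘(ℝ, V) g 0) :
    SmoothNear 𝓘(ℝ, H) 𝓘(ℝ, V) (fun h => f h • g h) 0 :=
  (SmoothNear.of_contMDiff
    (ContMDiffSMul.contMDiff_smul (I := 𝓘(ℝ, W)) (I' := 𝓘(ℝ, V)) (n := ∞))).comp (hf.prodMk hg)

instance mulAction : MulAction (PointJet r H W G) (PointJet r H V F) where
  one_smul i := by
    obtain ⟨f, hf, rfl⟩ := i.exists_rep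
    rw [← jetMk_one, jetMk_smul smoothNear_const hf]
    simp only [one_smul]
  mul_smul i j k := by
    obtain ⟨f, hf, rfl⟩ := i.exists_rep
    obtain ⟨g, hg, rfl⟩ := j.exists_rep
    obtain ⟨u, hu, rfl⟩ := k.exists_rep
    rw [jetMk_mul hf hg, jetMk_smul (smoothNear_mul hf hg) hu, jetMk_smul hg hu,
      jetMk_smul hf (smoothNear_smul hg hu)]
    simp only [mul_smul]

instance contMDiffSMul [FiniteDimensional ℝ H] [FiniteDimensional ℝ W] [FiniteDimensional ℝ V]
    [IsManifold 𝓘(ℝ, V) ∞ F] : ContMDiffSMul 𝓘(ℝ, JetModel r H W) 𝓘(ℝ, JetModel r H V) ∞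
      (PointJet r H W G) (PointJet r H V F) where
  contMDiff_smul := contMDiff_map₂ ContMDiffSMul.contMDiff_smul

end Groups

end PointJet

/-! ### Manifold structures from charts that are smooth in both directions. -/

section Atlases

variable {EX : Type*} [NormedAddCommGroup EX] [NormedSpace ℝ EX] {HX : Type*} [TopologicalSpace HX]
  {I : ModelWithCorners ℝ EX HX} {X : Type*} [TopologicalSpace X] [ChartedSpace HX X]

theorem mem_contDiffGroupoid_of_contMDiffOn {e : OpenPartialHomeomorph HX HX}
    (h : ContMDiffOn I I ∞ e e.source) (h' : ContMDiffOn I I ∞ e.symm e.target) :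
    e ∈ contDiffGroupoid ∞ I := by
  have key : ∀ {f : HX → HX} {s : Set HX}, ContMDiffOn I I ∞ f s →
      ContDiffOn ℝ ∞ (I ∘ f ∘ I.symm) (I.symm ⁻¹' s ∩ range I) := by
    intro f s hf z hz
    have := (contMDiffOn_iff.1 hf).2 (I.symm z) (I.symm z)
    simp only [chartAt_self_eq, mfld_simps] at this
    rw [inter_comm] at hz ⊢
    exact this z hz
  rw [contDiffGroupoid, mem_groupoid_of_pregroupoid]
  exact ⟨key h, key h'⟩

theorem mem_contDiffGroupoid_symm_trans {e e' : OpenPartialHomeomorph X HX}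
    (h₁ : ContMDiffOn I I ∞ e e.source) (h₂ : ContMDiffOn I I ∞ e.symm e.target)
    (h₁' : ContMDiffOn I I ∞ e' e'.source) (h₂' : ContMDiffOn I I ∞ e'.symm e'.target) :
    e.symm.trans e' ∈ contDiffGroupoid ∞ I := by
  apply mem_contDiffGroupoid_of_contMDiffOn
  · exact h₁'.comp (h₂.mono inter_subset_left) fun x hx => hx.2
  · refine h₁.comp (h₂'.mono ?_) fun x hx => ?_
    · rw [OpenPartialHomeomorph.trans_target]; exact inter_subset_left
    · rw [OpenPartialHomeomorph.trans_target] at hx; exact hx.2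

/-- Smoothness refers only to the preferred charts, so it makes sense before compatibility of the
atlas is known and can be used to prove it. -/
theorem isManifold_of_contMDiffOn_atlas
    (h : ∀ e ∈ atlas HX X, ContMDiffOn I I ∞ e e.source ∧ ContMDiffOn I I ∞ e.symm e.target) :
    IsManifold I ∞ X where
  compatible he he' := mem_contDiffGroupoid_symm_trans (h _ he).1 (h _ he).2 (h _ he').1 (h _ he').2

end Atlases

/-! ### Smooth trivializations and the manifold structure of a total space. -/

section FiberBundles

variable {M : Type*} [TopologicalSpace M]
  {H : Type*} [NormedAddCommGroup H] [NormedSpace ℝ H] [ChartedSpace H M]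
  {V : Type*} [NormedAddCommGroup V] [NormedSpace ℝ V]
  {F : Type*} [TopologicalSpace F] [ChartedSpace V F]
  {E : M → Type*} [TopologicalSpace (TotalSpace F E)] [∀ x, TopologicalSpace (E x)]
  [FiberBundle F E]

/-- The preferred chart at `p` is this trivialization followed by a product chart, so in charts the
map is the identity. -/
theorem contMDiffAt_trivializationAt (p : TotalSpace F E) :
    ContMDiffAt (𝓘(ℝ, H).prod 𝓘(ℝ, V)) (𝓘(ℝ, H).prod 𝓘(ℝ, V)) ∞
      (trivializationAt F E p.proj) p := by
  have hp : p ∈ (trivializationAt F E p.proj).source :=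
    (trivializationAt F E p.proj).mem_source.2 (mem_baseSet_trivializationAt F E p.proj)
  rw [contMDiffAt_iff]
  refine ⟨(trivializationAt F E p.proj).continuousAt hp, ?_⟩
  refine contDiffWithinAt_id.congr_of_eventuallyEq ?_ ?_
  · filter_upwards [extChartAt_target_mem_nhdsWithin (I := 𝓘(ℝ, H).prod 𝓘(ℝ, V)) p] with y hy
    exact (extChartAt (𝓘(ℝ, H).prod 𝓘(ℝ, V)) p).right_inv hy
  · exact (extChartAt (𝓘(ℝ, H).prod 𝓘(ℝ, V)) p).right_inv (mem_extChartAt_target p)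

theorem contMDiffAt_trivializationAt_symm (p : TotalSpace F E) :
    ContMDiffAt (𝓘(ℝ, H).prod 𝓘(ℝ, V)) (𝓘(ℝ, H).prod 𝓘(ℝ, V)) ∞
      (trivializationAt F E p.proj).toOpenPartialHomeomorph.symm
      (trivializationAt F E p.proj p) := by
  set e := trivializationAt F E p.proj with he
  have hp : p ∈ e.source := e.mem_source.2 (mem_baseSet_trivializationAt F E p.proj)
  have hp' : e.toOpenPartialHomeomorph.symm (e p) = p := e.toOpenPartialHomeomorph.left_inv hp
  rw [contMDiffAt_iff]
  refine ⟨e.toOpenPartialHomeomorph.symm.continuousAt (e.map_source hp), ?_⟩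
  have key : ∀ y ∈ (extChartAt (𝓘(ℝ, H).prod 𝓘(ℝ, V)) p).target,
      extChartAt (𝓘(ℝ, H).prod 𝓘(ℝ, V)) p (e.toOpenPartialHomeomorph.symm
        ((extChartAt (𝓘(ℝ, H).prod 𝓘(ℝ, V)) (e p)).symm y)) = y :=
    fun y hy => (extChartAt (𝓘(ℝ, H).prod 𝓘(ℝ, V)) p).right_inv hy
  rw [hp']
  refine contDiffWithinAt_id.congr_of_eventuallyEq ?_ ?_
  · filter_upwards [extChartAt_target_mem_nhdsWithin (I := 𝓘(ℝ, H).prod 𝓘(ℝ, V)) p] with y hy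
    exact key y hy
  · exact key _ (mem_extChartAt_target (I := 𝓘(ℝ, H).prod 𝓘(ℝ, V)) p)

namespace IsSmoothFiberBundle

variable (hE : IsSmoothFiberBundle H V F E)
include hE

/-- Near a point, `e` is the preferred trivialization there followed by a transition map, which is
smooth by assumption. -/
theorem isSmoothTrivialization (e : Trivialization F (π F E)) [MemTrivializationAtlas e] :
    IsSmoothTrivialization H V e := by
  refine ⟨fun p hp => ContMDiffAt.contMDiffWithinAt ?_, fun q hq => ContMDiffAt.contMDiffWithinAt ?_⟩
  · set e₀ := trivializationAt F E p.proj with he₀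
    have hp₀ : p ∈ e₀.source := e₀.mem_source.2 (mem_baseSet_trivializationAt F E p.proj)
    have hmem : e₀ p ∈
        (e₀.toOpenPartialHomeomorph.symm.trans e.toOpenPartialHomeomorph).source := by
      refine ⟨e₀.map_source hp₀, ?_⟩
      exact (congrArg (· ∈ e.source) (e₀.toOpenPartialHomeomorph.left_inv hp₀)).mpr hp
    have h1 := (hE.contMDiffOn_transition e₀ e).contMDiffAt
      ((OpenPartialHomeomorph.open_source _).mem_nhds hmem)
    refine (h1.comp p (contMDiffAt_trivializationAt p)).congr_of_eventuallyEq ?_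
    filter_upwards [e₀.open_source.mem_nhds hp₀] with y hy
    exact (congrArg e (e₀.toOpenPartialHomeomorph.left_inv hy)).symm
  · set p := e.toOpenPartialHomeomorph.symm q with hp
    set e₀ := trivializationAt F E p.proj with he₀
    have hp₀ : p ∈ e₀.source := e₀.mem_source.2 (mem_baseSet_trivializationAt F E p.proj)
    have hmem : q ∈ (e.toOpenPartialHomeomorph.symm.trans e₀.toOpenPartialHomeomorph).source :=
      ⟨hq, hp₀⟩
    have h1 := (hE.contMDiffOn_transition e e₀).contMDiffAt
      ((OpenPartialHomeomorph.open_source _).mem_nhds hmem)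
    have h2 := (contMDiffAt_trivializationAt_symm (H := H) (V := V) p).comp q h1
    refine h2.congr_of_eventuallyEq ?_
    filter_upwards [(OpenPartialHomeomorph.open_source _).mem_nhds hmem] with y hy
    exact (e₀.toOpenPartialHomeomorph.left_inv hy.2).symm

theorem isManifold [IsManifold 𝓘(ℝ, H) ∞ M] :
    IsManifold (𝓘(ℝ, H).prod 𝓘(ℝ, V)) ∞ (TotalSpace F E) := by
  have := hE.isManifold_fiber
  refine isManifold_of_contMDiffOn_atlas ?_
  rintro _ ⟨_, ⟨e, he, rfl⟩, c, hc, rfl⟩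
  have : MemTrivializationAtlas e := ⟨he⟩
  have hs := hE.isSmoothTrivialization e
  have hc := IsManifold.subset_maximalAtlas (I := 𝓘(ℝ, H).prod 𝓘(ℝ, V)) (n := ∞) hc
  constructor
  · exact (contMDiffOn_of_mem_maximalAtlas hc).comp (hs.1.mono inter_subset_left) fun x hx => hx.2
  · rw [OpenPartialHomeomorph.trans_target]
    exact hs.2.comp ((contMDiffOn_symm_of_mem_maximalAtlas hc).mono inter_subset_left)
      fun x hx => hx.2

theorem trans_mem_maximalAtlas [IsManifold 𝓘(ℝ, H) ∞ M] {e : Trivialization F (π F E)}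
    (he : IsSmoothTrivialization H V e) {c : OpenPartialHomeomorph (M × F) (ModelProd H V)}
    (hc : c ∈ IsManifold.maximalAtlas (𝓘(ℝ, H).prod 𝓘(ℝ, V)) ∞ (M × F)) :
    e.toOpenPartialHomeomorph.trans c ∈
      IsManifold.maximalAtlas (𝓘(ℝ, H).prod 𝓘(ℝ, V)) ∞ (TotalSpace F E) := by
  have := hE.isManifold
  refine OpenPartialHomeomorph.mem_maximalAtlas_of_contMDiffOn _ ?_ ?_
  · exact (contMDiffOn_of_mem_maximalAtlas hc).comp (he.1.mono inter_subset_left) fun x hx => hx.2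
  · rw [OpenPartialHomeomorph.trans_target]
    exact he.2.comp ((contMDiffOn_symm_of_mem_maximalAtlas hc).mono inter_subset_left)
      fun x hx => hx.2

end IsSmoothFiberBundle

namespace IsSmoothTrivialization

variable {e : Trivialization F (π F E)} (he : IsSmoothTrivialization H V e)
include he

theorem smoothNear {p : TotalSpace F E} (hp : p.proj ∈ e.baseSet) :
    SmoothNear (𝓘(ℝ, H).prod 𝓘(ℝ, V)) (𝓘(ℝ, H).prod 𝓘(ℝ, V)) e p :=
  .of_contMDiffOn he.1 (e.open_source.mem_nhds (e.mem_source.2 hp))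

theorem smoothNear_symm {q : M × F} (hq : q.1 ∈ e.baseSet) :
    SmoothNear (𝓘(ℝ, H).prod 𝓘(ℝ, V)) (𝓘(ℝ, H).prod 𝓘(ℝ, V))
      e.toOpenPartialHomeomorph.symm q :=
  .of_contMDiffOn he.2 (e.open_target.mem_nhds (e.mem_target.2 hq))

end IsSmoothTrivialization

end FiberBundles

/-! ### Elements of a fiber with given coordinate. -/

section FiberSymm

variable {M : Type*} [TopologicalSpace M] {F : Type*} [TopologicalSpace F]
  {E : M → Type*} [TopologicalSpace (TotalSpace F E)]

theorem exists_trivialization_apply_eq (e : Trivialization F (π F E)) {x : M} (hx : x ∈ e.baseSet)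
    (v : F) : ∃ a : E x, e ⟨x, a⟩ = (x, v) := by
  have h1 : e (e.toOpenPartialHomeomorph.symm (x, v)) = (x, v) := e.apply_symm_apply' hx
  have h2 : (e.toOpenPartialHomeomorph.symm (x, v)).proj = x := e.proj_symm_apply' hx
  generalize e.toOpenPartialHomeomorph.symm (x, v) = p at h1 h2
  obtain ⟨y, a⟩ := p
  obtain rfl : y = x := h2
  exact ⟨a, h1⟩

variable [∀ x, TopologicalSpace (E x)] [FiberBundle F E]

/-- Outside the base set any element of the fiber will do; another trivialization around `x` and the
given `v` provide one. -/
theorem exists_fiberSymm (e : Trivialization F (π F E)) (x : M) (v : F) :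
    ∃ a : E x, x ∈ e.baseSet → e ⟨x, a⟩ = (x, v) := by
  by_cases hx : x ∈ e.baseSet
  · obtain ⟨a, ha⟩ := exists_trivialization_apply_eq e hx v
    exact ⟨a, fun _ => ha⟩
  · obtain ⟨a, -⟩ := exists_trivialization_apply_eq (trivializationAt F E x)
      (mem_baseSet_trivializationAt F E x) v
    exact ⟨a, fun h => absurd h hx⟩

/-- The element of the fiber over `x` with given image under a trivialization. -/
def fiberSymm (e : Trivialization F (π F E)) (x : M) (v : F) : E x :=
  (exists_fiberSymm e x v).choose

variable {e : Trivialization F (π F E)} {x : M} (hx : x ∈ e.baseSet)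
include hx

theorem apply_fiberSymm (v : F) : e ⟨x, fiberSymm e x v⟩ = (x, v) :=
  (exists_fiberSymm e x v).choose_spec hx

theorem mk_fiberSymm (v : F) :
    (⟨x, fiberSymm e x v⟩ : TotalSpace F E) = e.toOpenPartialHomeomorph.symm (x, v) := by
  rw [← apply_fiberSymm hx v]
  exact (e.toOpenPartialHomeomorph.left_inv (e.mem_source.2 hx)).symm

theorem eq_of_trivialization_apply_eq {a b : E x} (h : (e ⟨x, a⟩).2 = (e ⟨x, b⟩).2) : a = b := by
  have h1 : e ⟨x, a⟩ = e ⟨x, b⟩ := by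
    refine Prod.ext ?_ h
    rw [e.coe_fst' hx, e.coe_fst' hx]
  have := e.toOpenPartialHomeomorph.injOn (e.mem_source.2 hx) (e.mem_source.2 hx) h1
  exact (TotalSpace.mk_inj).1 this

theorem fiberSymm_apply (a : E x) : fiberSymm e x (e ⟨x, a⟩).2 = a :=
  eq_of_trivialization_apply_eq hx (by rw [apply_fiberSymm hx])

end FiberSymm

/-! ### Smoothness of locally constant fiberwise maps. -/

section Homs

variable {M : Type*} [TopologicalSpace M]
  {H : Type*} [NormedAddCommGroup H] [NormedSpace ℝ H] [ChartedSpace H M]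
  {V₁ : Type*} [NormedAddCommGroup V₁] [NormedSpace ℝ V₁]
  {F₁ : Type*} [TopologicalSpace F₁] [ChartedSpace V₁ F₁]
  {E₁ : M → Type*} [TopologicalSpace (TotalSpace F₁ E₁)] [∀ x, TopologicalSpace (E₁ x)]
  [FiberBundle F₁ E₁]
  {V₂ : Type*} [NormedAddCommGroup V₂] [NormedSpace ℝ V₂]
  {F₂ : Type*} [TopologicalSpace F₂] [ChartedSpace V₂ F₂]
  {E₂ : M → Type*} [TopologicalSpace (TotalSpace F₂ E₂)] [∀ x, TopologicalSpace (E₂ x)]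
  [FiberBundle F₂ E₂]
  {V₃ : Type*} [NormedAddCommGroup V₃] [NormedSpace ℝ V₃]
  {F₃ : Type*} [TopologicalSpace F₃] [ChartedSpace V₃ F₃]
  {E₃ : M → Type*} [TopologicalSpace (TotalSpace F₃ E₃)] [∀ x, TopologicalSpace (E₃ x)]
  [FiberBundle F₃ E₃]

/-- A family of maps between the fibers that is constant in suitable smooth local trivializations
is a smooth homomorphism. -/
theorem isSmoothHomFiberProd_of_locallyConstant (h₁ : IsSmoothFiberBundle H V₁ F₁ E₁)
    (h₂ : IsSmoothFiberBundle H V₂ F₂ E₂) (h₃ : IsSmoothFiberBundle H V₃ F₃ E₃)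
    {f : ∀ x, E₁ x → E₂ x → E₃ x} {μ : F₁ → F₂ → F₃}
    (hμ : ContMDiff (𝓘(ℝ, V₁).prod 𝓘(ℝ, V₂)) 𝓘(ℝ, V₃) ∞ fun p : F₁ × F₂ => μ p.1 p.2)
    (hf : ∀ x : M, ∃ (d₁ : Trivialization F₁ (π F₁ E₁)) (d₂ : Trivialization F₂ (π F₂ E₂))
      (d₃ : Trivialization F₃ (π F₃ E₃)), (x ∈ d₁.baseSet ∧ x ∈ d₂.baseSet ∧ x ∈ d₃.baseSet) ∧
      IsSmoothTrivialization H V₁ d₁ ∧ IsSmoothTrivialization H V₂ d₂ ∧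
      IsSmoothTrivialization H V₃ d₃ ∧
      ∀ y, y ∈ d₁.baseSet → y ∈ d₂.baseSet → y ∈ d₃.baseSet → ∀ (a : E₁ y) (b : E₂ y),
        (d₃ ⟨y, f y a b⟩).2 = μ (d₁ ⟨y, a⟩).2 (d₂ ⟨y, b⟩).2) :
    IsSmoothHomFiberProd H V₁ F₁ V₂ F₂ V₃ F₃ f := by
  intro e₁ e₂ e₃ _ _ _
  have he₁ := h₁.isSmoothTrivialization e₁
  have he₂ := h₂.isSmoothTrivialization e₂
  have he₃ := h₃.isSmoothTrivialization e₃
  refine ⟨fun p => (e₃ ⟨p.1, f p.1 (fiberSymm e₁ p.1 p.2.1) (fiberSymm e₂ p.1 p.2.2)⟩).2, ?_, ?_⟩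
  · rintro ⟨x, v₁, v₂⟩ ⟨⟨⟨hx₁, hx₂⟩, hx₃⟩, -⟩
    obtain ⟨d₁, d₂, d₃, ⟨hd₁, hd₂, hd₃⟩, hs₁, hs₂, hs₃, hd⟩ := hf x
    let I := 𝓘(ℝ, H).prod (𝓘(ℝ, V₁).prod 𝓘(ℝ, V₂))
    let p : M × F₁ × F₂ := (x, v₁, v₂)
    -- Near `x` the map is factored as transition from `e₁`, `e₂` to `d₁`, `d₂`, then `μ`, then
    -- transition from `d₃` to `e₃`.
    have a₁ : SmoothNear I 𝓘(ℝ, V₁) (fun q : M × F₁ × F₂ =>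
        (d₁ (e₁.toOpenPartialHomeomorph.symm (q.1, q.2.1))).2) p := by
      have := he₁.smoothNear_symm (q := (x, v₁)) hx₁
      refine ((hs₁.smoothNear (p := e₁.toOpenPartialHomeomorph.symm (x, v₁)) ?_).comp_of_eq
        (this.comp_of_eq (f := fun q : M × F₁ × F₂ => (q.1, q.2.1))
        (smoothNear_fst.prodMk smoothNear_snd.fst) rfl) rfl).snd
      rwa [e₁.proj_symm_apply' hx₁]
    have a₂ : SmoothNear I 𝓘(ℝ, V₂) (fun q : M × F₁ × F₂ =>
        (d₂ (e₂.toOpenPartialHomeomorph.symm (q.1, q.2.2))).2) p := by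
      have := he₂.smoothNear_symm (q := (x, v₂)) hx₂
      refine ((hs₂.smoothNear (p := e₂.toOpenPartialHomeomorph.symm (x, v₂)) ?_).comp_of_eq
        (this.comp_of_eq (f := fun q : M × F₁ × F₂ => (q.1, q.2.2))
        (smoothNear_fst.prodMk smoothNear_snd.snd) rfl) rfl).snd
      rwa [e₂.proj_symm_apply' hx₂]
    have a₃ : SmoothNear I (𝓘(ℝ, H).prod 𝓘(ℝ, V₃)) (fun q : M × F₁ × F₂ =>
        (q.1, μ (d₁ (e₁.toOpenPartialHomeomorph.symm (q.1, q.2.1))).2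
          (d₂ (e₂.toOpenPartialHomeomorph.symm (q.1, q.2.2))).2)) p :=
      smoothNear_fst.prodMk
        ((SmoothNear.of_contMDiff hμ).comp_of_eq (a₁.prodMk a₂) rfl)
    have a₄ : SmoothNear I 𝓘(ℝ, V₃) (fun q : M × F₁ × F₂ =>
        (e₃ (d₃.toOpenPartialHomeomorph.symm
          (q.1, μ (d₁ (e₁.toOpenPartialHomeomorph.symm (q.1, q.2.1))).2
          (d₂ (e₂.toOpenPartialHomeomorph.symm (q.1, q.2.2))).2))).2) p := by
      refine ((he₃.smoothNear (p := d₃.toOpenPartialHomeomorph.symm (x, _)) ?_).comp_of_eq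
        ((hs₃.smoothNear_symm (q := (x, _)) hd₃).comp_of_eq a₃ rfl) rfl).snd
      rwa [d₃.proj_symm_apply' hd₃]
    refine (a₄.contMDiffAt.congr_of_eventuallyEq ?_).contMDiffWithinAt
    have hU : ∀ᶠ q : M × F₁ × F₂ in 𝓝 p, q.1 ∈ e₁.baseSet ∧ q.1 ∈ e₂.baseSet ∧
        q.1 ∈ d₁.baseSet ∧ q.1 ∈ d₂.baseSet ∧ q.1 ∈ d₃.baseSet :=
      continuousAt_fst.eventually ((e₁.open_baseSet.eventually_mem hx₁).and
        ((e₂.open_baseSet.eventually_mem hx₂).and ((d₁.open_baseSet.eventually_mem hd₁).and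
        ((d₂.open_baseSet.eventually_mem hd₂).and (d₃.open_baseSet.eventually_mem hd₃)))))
    filter_upwards [hU] with q ⟨hq₁, hq₂, hq₃, hq₄, hq₅⟩
    rw [← mk_fiberSymm hq₁, ← mk_fiberSymm hq₂, ← hd _ hq₃ hq₄ hq₅, ← mk_fiberSymm hq₅,
      fiberSymm_apply hq₅]
  · rintro x ⟨⟨hx₁, hx₂⟩, -⟩ a b
    simp only [fiberSymm_apply hx₁, fiberSymm_apply hx₂]

end Homs

/-! ### Lie group bundles from local constancy of the fiberwise group structure. -/

section LieGroupBundles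

variable {M : Type*} [TopologicalSpace M]
  {H : Type*} [NormedAddCommGroup H] [NormedSpace ℝ H] [ChartedSpace H M]
  {W : Type*} [NormedAddCommGroup W] [NormedSpace ℝ W]
  {G : Type*} [TopologicalSpace G] [ChartedSpace W G] [Group G]
  {𝒢 : M → Type*} [TopologicalSpace (TotalSpace G 𝒢)] [∀ x, TopologicalSpace (𝒢 x)]
  [FiberBundle G 𝒢] [∀ x, Group (𝒢 x)]

theorem IsGroupTrivialization.apply_one {e : Trivialization G (π G 𝒢)}
    (he : IsGroupTrivialization H W e) {x : M} (hx : x ∈ e.baseSet) :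
    (e ⟨x, 1⟩).2 = 1 := by
  have := he.2 x hx 1 1
  rw [mul_one] at this
  exact left_eq_mul.1 this

theorem IsGroupTrivialization.apply_inv {e : Trivialization G (π G 𝒢)}
    (he : IsGroupTrivialization H W e) {x : M} (hx : x ∈ e.baseSet) (a : 𝒢 x) :
    (e ⟨x, a⁻¹⟩).2 = (e ⟨x, a⟩).2⁻¹ := by
  rw [eq_inv_iff_mul_eq_one, ← he.2 x hx, inv_mul_cancel, he.apply_one hx]

/-- A smooth fiber bundle with locally constant Lie group structures on its fibers is a Lie group
bundle. -/
theorem isLieGroupBundle_of_locallyConstant (hE : IsSmoothFiberBundle H W G 𝒢)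
    [hG : LieGroup 𝓘(ℝ, W) ∞ G]
    (hloc : ∀ x : M, ∃ e : Trivialization G (π G 𝒢), x ∈ e.baseSet ∧ IsGroupTrivialization H W e) :
    IsLieGroupBundle H W G 𝒢 where
  isSmoothFiberBundle := hE
  lieGroup := hG
  locallyConstant := hloc
  smooth_mul := by
    refine isSmoothHomFiberProd_of_locallyConstant hE hE hE (contMDiff_mul 𝓘(ℝ, W) ∞) fun x => ?_
    obtain ⟨e, hx, he⟩ := hloc x
    exact ⟨e, e, e, ⟨hx, hx, hx⟩, he.1, he.1, he.1, fun y hy _ _ => he.2 y hy⟩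
  smooth_one := by
    intro x
    obtain ⟨e, hx, he⟩ := hloc x
    have h1 : SmoothNear 𝓘(ℝ, H) (𝓘(ℝ, H).prod 𝓘(ℝ, W))
        (fun y : M => e.toOpenPartialHomeomorph.symm (y, 1)) x :=
      (he.1.smoothNear_symm (q := (x, 1)) hx).comp_of_eq (smoothNear_id.prodMk smoothNear_const) rfl
    refine h1.contMDiffAt.congr_of_eventuallyEq ?_
    filter_upwards [e.open_baseSet.eventually_mem hx] with y hy
    rw [← mk_fiberSymm hy, ← he.apply_one hy, fiberSymm_apply hy]
  smooth_inv := by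
    intro p
    obtain ⟨e, hx, he⟩ := hloc p.proj
    have h0 := he.1.smoothNear hx
    have h1 : SmoothNear (𝓘(ℝ, H).prod 𝓘(ℝ, W)) (𝓘(ℝ, H).prod 𝓘(ℝ, W))
        (fun q : TotalSpace G 𝒢 => e.toOpenPartialHomeomorph.symm ((e q).1, (e q).2⁻¹)) p := by
      refine (he.1.smoothNear_symm (q := ((e p).1, (e p).2⁻¹)) ?_).comp_of_eq
        (f := fun q => ((e q).1, (e q).2⁻¹))
        (h0.fst.prodMk ((SmoothNear.of_contMDiff (contMDiff_inv 𝓘(ℝ, W) ∞)).comp h0.snd)) rfl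
      rwa [e.coe_fst' hx]
    refine h1.contMDiffAt.congr_of_eventuallyEq ?_
    filter_upwards [e.open_source.eventually_mem (e.mem_source.2 hx)] with q hq
    have hq := e.mem_source.1 hq
    rw [e.coe_fst' hq, ← he.apply_inv hq, ← mk_fiberSymm hq, fiberSymm_apply hq]

end LieGroupBundles

/-! ### Fiberwise operations on local sections and their jets. -/

section LocalSections

variable {M : Type*} [TopologicalSpace M]
  {H : Type*} [NormedAddCommGroup H] [NormedSpace ℝ H] [ChartedSpace H M]
  {V : Type*} [NormedAddCommGroup V] [NormedSpace ℝ V]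
  {F : Type*} [TopologicalSpace F] [ChartedSpace V F]
  {E : M → Type*} [TopologicalSpace (TotalSpace F E)] [∀ x, TopologicalSpace (E x)]
  [FiberBundle F E] {r : ℕ} {x : M}

theorem LocalSection.smoothNear (s : LocalSection H V F E x) :
    SmoothNear 𝓘(ℝ, H) (𝓘(ℝ, H).prod 𝓘(ℝ, V)) (fun z => (⟨z, s.1 z⟩ : TotalSpace F E)) x :=
  s.2

theorem jet_eq_iff {s t : LocalSection H V F E x} : jet r s = jet r t ↔
    JetEq 𝓘(ℝ, H) (𝓘(ℝ, H).prod 𝓘(ℝ, V)) r (fun z => (⟨z, s.1 z⟩ : TotalSpace F E))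
      (fun z => (⟨z, t.1 z⟩ : TotalSpace F E)) x := by
  refine Quotient.eq.trans ?_
  exact and_congr_left' (TotalSpace.mk_inj).symm

theorem exists_jet_eq (ξ : JetFiber H V F E r x) : ∃ s : LocalSection H V F E x, jet r s = ξ :=
  Quotient.exists_rep ξ

end LocalSections

section Homs

variable {M : Type*} [TopologicalSpace M]
  {H : Type*} [NormedAddCommGroup H] [NormedSpace ℝ H] [ChartedSpace H M]
  {V₁ : Type*} [NormedAddCommGroup V₁] [NormedSpace ℝ V₁]
  {F₁ : Type*} [TopologicalSpace F₁] [ChartedSpace V₁ F₁]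
  {E₁ : M → Type*} [TopologicalSpace (TotalSpace F₁ E₁)] [∀ x, TopologicalSpace (E₁ x)]
  [FiberBundle F₁ E₁]
  {V₂ : Type*} [NormedAddCommGroup V₂] [NormedSpace ℝ V₂]
  {F₂ : Type*} [TopologicalSpace F₂] [ChartedSpace V₂ F₂]
  {E₂ : M → Type*} [TopologicalSpace (TotalSpace F₂ E₂)] [∀ x, TopologicalSpace (E₂ x)]
  [FiberBundle F₂ E₂]
  {V₃ : Type*} [NormedAddCommGroup V₃] [NormedSpace ℝ V₃]
  {F₃ : Type*} [TopologicalSpace F₃] [ChartedSpace V₃ F₃]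
  {E₃ : M → Type*} [TopologicalSpace (TotalSpace F₃ E₃)] [∀ x, TopologicalSpace (E₃ x)]
  [FiberBundle F₃ E₃] {r : ℕ} {x : M} {f : ∀ x, E₁ x → E₂ x → E₃ x}

/-- A smooth homomorphism `E₁ ×_M E₂ → E₃` extends locally to a smooth map on `E₁ × E₂`. -/
theorem IsSmoothHomFiberProd.exists_extension (hf : IsSmoothHomFiberProd H V₁ F₁ V₂ F₂ V₃ F₃ f)
    (h₁ : IsSmoothFiberBundle H V₁ F₁ E₁)
    (h₂ : IsSmoothFiberBundle H V₂ F₂ E₂) (h₃ : IsSmoothFiberBundle H V₃ F₃ E₃) (x : M) :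
    ∃ Θ : TotalSpace F₁ E₁ × TotalSpace F₂ E₂ → TotalSpace F₃ E₃,
      (∀ a b, SmoothNear ((𝓘(ℝ, H).prod 𝓘(ℝ, V₁)).prod (𝓘(ℝ, H).prod 𝓘(ℝ, V₂)))
        (𝓘(ℝ, H).prod 𝓘(ℝ, V₃)) Θ (⟨x, a⟩, ⟨x, b⟩)) ∧
      ∀ᶠ z in 𝓝 x, ∀ a b, Θ (⟨z, a⟩, ⟨z, b⟩) = ⟨z, f z a b⟩ := by
  let e₁ := trivializationAt F₁ E₁ x
  let e₂ := trivializationAt F₂ E₂ x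
  let e₃ := trivializationAt F₃ E₃ x
  have hx₁ : x ∈ e₁.baseSet := mem_baseSet_trivializationAt F₁ E₁ x
  have hx₂ : x ∈ e₂.baseSet := mem_baseSet_trivializationAt F₂ E₂ x
  have hx₃ : x ∈ e₃.baseSet := mem_baseSet_trivializationAt F₃ E₃ x
  have he₁ := h₁.isSmoothTrivialization e₁
  have he₂ := h₂.isSmoothTrivialization e₂
  have he₃ := h₃.isSmoothTrivialization e₃
  obtain ⟨φ, hφ, hφ'⟩ := hf e₁ e₂ e₃
  -- The base point of the second argument is ignored. This extends `f` off the fiber product, so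
  -- that the chain rule applies to a map on an honest product manifold.
  refine ⟨fun p => e₃.toOpenPartialHomeomorph.symm
    ((e₁ p.1).1, φ ((e₁ p.1).1, (e₁ p.1).2, (e₂ p.2).2)), fun a b => ?_, ?_⟩
  · let I := (𝓘(ℝ, H).prod 𝓘(ℝ, V₁)).prod (𝓘(ℝ, H).prod 𝓘(ℝ, V₂))
    let p : TotalSpace F₁ E₁ × TotalSpace F₂ E₂ := (⟨x, a⟩, ⟨x, b⟩)
    have a₁ : SmoothNear I (𝓘(ℝ, H).prod 𝓘(ℝ, V₁))
        (fun p : TotalSpace F₁ E₁ × TotalSpace F₂ E₂ => e₁ p.1) p :=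
      (he₁.smoothNear (p := ⟨x, a⟩) hx₁).comp_of_eq smoothNear_fst rfl
    have a₂ : SmoothNear I (𝓘(ℝ, H).prod 𝓘(ℝ, V₂))
        (fun p : TotalSpace F₁ E₁ × TotalSpace F₂ E₂ => e₂ p.2) p :=
      (he₂.smoothNear (p := ⟨x, b⟩) hx₂).comp_of_eq smoothNear_snd rfl
    have a₃ : SmoothNear (𝓘(ℝ, H).prod (𝓘(ℝ, V₁).prod 𝓘(ℝ, V₂))) 𝓘(ℝ, V₃) φ
        ((e₁ ⟨x, a⟩).1, (e₁ ⟨x, a⟩).2, (e₂ ⟨x, b⟩).2) := by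
      refine .of_contMDiffOn hφ (((e₁.open_baseSet.inter e₂.open_baseSet).inter
        e₃.open_baseSet).prod isOpen_univ |>.mem_nhds ⟨?_, trivial⟩)
      have hx' : (e₁ ⟨x, a⟩).1 = x := e₁.coe_fst' (x := ⟨x, a⟩) hx₁
      simp only [hx']
      exact ⟨⟨hx₁, hx₂⟩, hx₃⟩
    have a₄ : SmoothNear I 𝓘(ℝ, V₃) (fun p : TotalSpace F₁ E₁ × TotalSpace F₂ E₂ =>
        φ ((e₁ p.1).1, (e₁ p.1).2, (e₂ p.2).2)) p :=
      a₃.comp_of_eq (a₁.fst.prodMk (a₁.snd.prodMk a₂.snd)) rfl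
    refine (he₃.smoothNear_symm (q := ((e₁ ⟨x, a⟩).1, _)) ?_).comp_of_eq (a₁.fst.prodMk a₄) rfl
    rwa [e₁.coe_fst' hx₁]
  · filter_upwards [e₁.open_baseSet.eventually_mem hx₁, e₂.open_baseSet.eventually_mem hx₂,
      e₃.open_baseSet.eventually_mem hx₃] with z hz₁ hz₂ hz₃ a b
    rw [e₁.coe_fst' hz₁, ← hφ' z ⟨⟨hz₁, hz₂⟩, hz₃⟩ a b, ← mk_fiberSymm hz₃, fiberSymm_apply hz₃]

/-- The image of two local sections under a smooth homomorphism. -/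
def LocalSection.map₂ (hf : IsSmoothHomFiberProd H V₁ F₁ V₂ F₂ V₃ F₃ f)
    (h₁ : IsSmoothFiberBundle H V₁ F₁ E₁) (h₂ : IsSmoothFiberBundle H V₂ F₂ E₂)
    (h₃ : IsSmoothFiberBundle H V₃ F₃ E₃) (s : LocalSection H V₁ F₁ E₁ x)
    (t : LocalSection H V₂ F₂ E₂ x) : LocalSection H V₃ F₃ E₃ x :=
  ⟨fun y => f y (s.1 y) (t.1 y), by
    obtain ⟨Θ, hΘ, hΘ'⟩ := hf.exists_extension h₁ h₂ h₃ x
    refine ((hΘ _ _).comp_of_eq (s.smoothNear.prodMk t.smoothNear) rfl).congr ?_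
    filter_upwards [hΘ'] with z hz using (hz _ _).symm⟩

/-- The map induced on jets by a smooth homomorphism `E₁ ×_M E₂ → E₃`. -/
def JetFiber.map₂ (hf : IsSmoothHomFiberProd H V₁ F₁ V₂ F₂ V₃ F₃ f)
    (h₁ : IsSmoothFiberBundle H V₁ F₁ E₁) (h₂ : IsSmoothFiberBundle H V₂ F₂ E₂)
    (h₃ : IsSmoothFiberBundle H V₃ F₃ E₃) :
    JetFiber H V₁ F₁ E₁ r x → JetFiber H V₂ F₂ E₂ r x → JetFiber H V₃ F₃ E₃ r x :=
  Quotient.lift₂ (fun s t => jet r (LocalSection.map₂ hf h₁ h₂ h₃ s t)) (by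
    intro s t s' t' hs ht
    obtain ⟨Θ, hΘ, hΘ'⟩ := hf.exists_extension h₁ h₂ h₃ x
    have hs := jet_eq_iff.1 (Quotient.sound hs)
    have ht := jet_eq_iff.1 (Quotient.sound ht)
    refine jet_eq_iff.2 (jetEq_congr ?_ ?_ ((hs.prodMk ht s.smoothNear.contMDiffAt
      s'.smoothNear.contMDiffAt t.smoothNear.contMDiffAt t'.smoothNear.contMDiffAt).comp_left
      (s.smoothNear.prodMk t.smoothNear).contMDiffAt
      (s'.smoothNear.prodMk t'.smoothNear).contMDiffAt (hΘ _ _).contMDiffAt))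
    · filter_upwards [hΘ'] with z hz using (hz _ _).symm
    · filter_upwards [hΘ'] with z hz using (hz _ _).symm)

end Homs

section Groups

variable {M : Type*} [TopologicalSpace M]
  {H : Type*} [NormedAddCommGroup H] [NormedSpace ℝ H] [ChartedSpace H M]
  {W : Type*} [NormedAddCommGroup W] [NormedSpace ℝ W]
  {G : Type*} [TopologicalSpace G] [ChartedSpace W G] [Group G]
  {𝒢 : M → Type*} [TopologicalSpace (TotalSpace G 𝒢)] [∀ x, TopologicalSpace (𝒢 x)]
  [FiberBundle G 𝒢] [∀ x, Group (𝒢 x)] {r : ℕ} {x : M}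

section

variable (hG : IsLieGroupBundle H W G 𝒢)
include hG

/-- The product of local sections of a Lie group bundle. -/
def LocalSection.mul (s t : LocalSection H W G 𝒢 x) : LocalSection H W G 𝒢 x :=
  .map₂ hG.smooth_mul hG.isSmoothFiberBundle hG.isSmoothFiberBundle hG.isSmoothFiberBundle s t

/-- The unit section of a Lie group bundle. -/
def LocalSection.one : LocalSection H W G 𝒢 x :=
  ⟨fun _ => 1, SmoothNear.of_contMDiff hG.smooth_one⟩

/-- The inverse of a local section of a Lie group bundle. -/
def LocalSection.inv (s : LocalSection H W G 𝒢 x) : LocalSection H W G 𝒢 x :=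
  ⟨fun y => (s.1 y)⁻¹, (SmoothNear.of_contMDiff hG.smooth_inv).comp s.smoothNear⟩

/-- The inverse of a jet. -/
def JetFiber.inv : JetFiber H W G 𝒢 r x → JetFiber H W G 𝒢 r x :=
  Quotient.lift (fun s => jet r (LocalSection.inv hG s)) (by
    intro s t hs
    have hs := jet_eq_iff.1 (Quotient.sound hs)
    exact jet_eq_iff.2 (hs.comp_left s.smoothNear.contMDiffAt t.smoothNear.contMDiffAt
      (hG.smooth_inv _)))

/-- The fibers of the jet bundle of a Lie group bundle are groups. -/
@[reducible] def JetFiber.group : Group (JetFiber H W G 𝒢 r x) :=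
  letI : Mul (JetFiber H W G 𝒢 r x) := ⟨JetFiber.map₂ hG.smooth_mul hG.isSmoothFiberBundle
    hG.isSmoothFiberBundle hG.isSmoothFiberBundle⟩
  letI : One (JetFiber H W G 𝒢 r x) := ⟨jet r (LocalSection.one hG)⟩
  letI : Inv (JetFiber H W G 𝒢 r x) := ⟨JetFiber.inv hG⟩
  -- Operations on representatives are pointwise, so each axiom is already an equality of local
  -- sections.
  Group.ofLeftAxioms
    (fun i j k => by
      induction i using Quotient.ind
      induction j using Quotient.ind
      induction k using Quotient.ind
      exact congrArg (jet r) (Subtype.ext (funext fun y => mul_assoc _ _ _)))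
    (fun i => by
      induction i using Quotient.ind
      exact congrArg (jet r) (Subtype.ext (funext fun y => one_mul _)))
    (fun i => by
      induction i using Quotient.ind
      exact congrArg (jet r) (Subtype.ext (funext fun y => inv_mul_cancel _)))

end

variable {V : Type*} [NormedAddCommGroup V] [NormedSpace ℝ V]
  {F : Type*} [TopologicalSpace F] [ChartedSpace V F]
  {E : M → Type*} [TopologicalSpace (TotalSpace F E)] [∀ x, TopologicalSpace (E x)]
  [FiberBundle F E] [∀ x, MulAction (𝒢 x) (E x)]
  (hG : IsLieGroupBundle H W G 𝒢) (hE : IsSmoothFiberBundle H V F E)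
  (hact : IsLieGroupBundleAction H W G 𝒢 V F E)
include hG hE hact

/-- The action of local sections of a Lie group bundle on local sections. -/
def LocalSection.smul (s : LocalSection H W G 𝒢 x) (t : LocalSection H V F E x) :
    LocalSection H V F E x :=
  .map₂ hact.smooth_smul hG.isSmoothFiberBundle hE hE s t

/-- The action of jets of sections of a Lie group bundle on jets of sections. -/
@[reducible] def JetFiber.mulAction :
    letI := JetFiber.group hG (r := r) (x := x)
    MulAction (JetFiber H W G 𝒢 r x) (JetFiber H V F E r x) :=
  letI := JetFiber.group hG (r := r) (x := x)
  { smul := JetFiber.map₂ hact.smooth_smul hG.isSmoothFiberBundle hE hE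
    one_smul := fun i => by
      induction i using Quotient.ind
      exact congrArg (jet r) (Subtype.ext (funext fun y => one_smul _ _))
    mul_smul := fun i j k => by
      induction i using Quotient.ind
      induction j using Quotient.ind
      induction k using Quotient.ind
      exact congrArg (jet r) (Subtype.ext (funext fun y => mul_smul _ _ _)) }

end Groups

section Shift

variable {EX : Type*} [NormedAddCommGroup EX] [NormedSpace ℝ EX] {HX : Type*} [TopologicalSpace HX]
  {I : ModelWithCorners ℝ EX HX} {X : Type*} [TopologicalSpace X] [ChartedSpace HX X]
  {A : Type*} [NormedAddCommGroup A] [NormedSpace ℝ A] {f g : X → A} {x : X}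

theorem SmoothNear.add (hf : SmoothNear I 𝓘(ℝ, A) f x) (hg : SmoothNear I 𝓘(ℝ, A) g x) :
    SmoothNear I 𝓘(ℝ, A) (fun y => f y + g y) x := by
  filter_upwards [hf, hg] with y hy hy' using hy.add hy'

theorem SmoothNear.sub (hf : SmoothNear I 𝓘(ℝ, A) f x) (hg : SmoothNear I 𝓘(ℝ, A) g x) :
    SmoothNear I 𝓘(ℝ, A) (fun y => f y - g y) x := by
  filter_upwards [hf, hg] with y hy hy' using hy.sub hy'

end Shift

/-! ### Local trivializations, topology and smooth charts of the jet bundle. -/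

section JetCoordinates

variable {M : Type*} [TopologicalSpace M]
  {H : Type*} [NormedAddCommGroup H] [NormedSpace ℝ H] [ChartedSpace H M]
  {V : Type*} [NormedAddCommGroup V] [NormedSpace ℝ V]
  {F : Type*} [TopologicalSpace F] [ChartedSpace V F]
  {E : M → Type*} [TopologicalSpace (TotalSpace F E)] [∀ x, TopologicalSpace (E x)]
  [FiberBundle F E] {r : ℕ}

/-- The representative of a section in a chart of the base centered at `x` and a local
trivialization. -/
def jetCoord (φ : OpenPartialHomeomorph M H) (e : Trivialization F (π F E)) (x : M)
    (s : ∀ y, E y) (h : H) : F :=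
  (e ⟨φ.symm (φ x + h), s (φ.symm (φ x + h))⟩).2

variable {φ φ' : OpenPartialHomeomorph M H} {e e' : Trivialization F (π F E)} {x : M}

theorem symm_add_zero (hx : x ∈ φ.source) : φ.symm (φ x + 0) = x := by
  rw [add_zero, φ.left_inv hx]

theorem jetCoord_zero (hx : x ∈ φ.source) (s : ∀ y, E y) :
    jetCoord φ e x s 0 = (e ⟨x, s x⟩).2 := by
  rw [jetCoord, symm_add_zero hx]

section

variable (hφ : φ ∈ IsManifold.maximalAtlas 𝓘(ℝ, H) ∞ M) (he : IsSmoothTrivialization H V e)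
  (hφ' : φ' ∈ IsManifold.maximalAtlas 𝓘(ℝ, H) ∞ M) (he' : IsSmoothTrivialization H V e')
  (hx : x ∈ φ.source) (hxe : x ∈ e.baseSet) (hx' : x ∈ φ'.source) (hxe' : x ∈ e'.baseSet)

include hφ hx in
theorem smoothNear_symm_add : SmoothNear 𝓘(ℝ, H) 𝓘(ℝ, H) (fun h => φ.symm (φ x + h)) 0 :=
  (smoothNear_symm_of_mem_maximalAtlas hφ (φ.map_source hx)).comp_of_eq
    (smoothNear_const.add smoothNear_id) (add_zero _)

include hφ hx in
theorem smoothNear_sub_chart : SmoothNear 𝓘(ℝ, H) 𝓘(ℝ, H) (fun y => φ y - φ x) x :=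
  (smoothNear_of_mem_maximalAtlas hφ hx).sub smoothNear_const

include hφ he hx hxe

omit he in
theorem eventually_symm_mem_baseSet : ∀ᶠ h in 𝓝 (0 : H), φ.symm (φ x + h) ∈ e.baseSet :=
  (smoothNear_symm_add hφ hx).contMDiffAt.continuousAt.eventually
    (e.open_baseSet.eventually_mem (by simpa only [symm_add_zero hx] using hxe))

theorem smoothNear_jetCoord (s : LocalSection H V F E x) :
    SmoothNear 𝓘(ℝ, H) 𝓘(ℝ, V) (jetCoord φ e x s.1) 0 :=
  ((he.smoothNear (p := ⟨x, s.1 x⟩) hxe).comp_of_eq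
    (s.smoothNear.comp_of_eq (smoothNear_symm_add hφ hx) (symm_add_zero hx))
    (by rw [symm_add_zero hx])).snd

/-- The representative is the section composed with `e` on one side and with a translated inverse
chart on the other, and both compositions preserve equality of jets. So the coordinate of a jet is
well defined; `jet_sectionOf_eq` does the same for the inverse. -/
theorem jetMk_jetCoord_eq {s t : LocalSection H V F E x} (hst : jet r s = jet r t) :
    jetMk r V (jetCoord φ e x s.1) = jetMk r V (jetCoord φ e x t.1) := by
  rw [jetMk_eq_iff (smoothNear_jetCoord hφ he hx hxe s) (smoothNear_jetCoord hφ he hx hxe t)]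
  have hs := he.smoothNear (p := ⟨x, s.1 x⟩) hxe
  have ht := he.smoothNear (p := ⟨x, t.1 x⟩) hxe
  exact ((jet_eq_iff.1 hst).comp_left s.smoothNear.contMDiffAt t.smoothNear.contMDiffAt
    hs.snd.contMDiffAt).comp_right_of_eq (smoothNear_symm_add hφ hx).contMDiffAt
    (hs.snd.comp_of_eq s.smoothNear rfl).contMDiffAt (ht.snd.comp_of_eq t.smoothNear rfl).contMDiffAt
    (symm_add_zero hx)

theorem smoothNear_section {f : H → F} (hf : SmoothNear 𝓘(ℝ, H) 𝓘(ℝ, V) f 0) :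
    SmoothNear 𝓘(ℝ, H) (𝓘(ℝ, H).prod 𝓘(ℝ, V))
      (fun y => e.toOpenPartialHomeomorph.symm (y, f (φ y - φ x))) x :=
  (he.smoothNear_symm (q := (x, _)) hxe).comp_of_eq (smoothNear_id.prodMk
    (hf.comp_of_eq (smoothNear_sub_chart hφ hx) (sub_self _))) rfl

/-- The section of a bundle with given representative in a chart of the base centered at `x` and a
local trivialization. -/
def sectionOf (f : H → F) (hf : SmoothNear 𝓘(ℝ, H) 𝓘(ℝ, V) f 0) : LocalSection H V F E x :=
  ⟨fun y => fiberSymm e y (f (φ y - φ x)), (smoothNear_section hφ he hx hxe hf).congr (by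
    filter_upwards [e.open_baseSet.eventually_mem hxe] with y hy using mk_fiberSymm hy _)⟩

theorem mk_sectionOf_eventuallyEq {f : H → F} (hf : SmoothNear 𝓘(ℝ, H) 𝓘(ℝ, V) f 0) :
    (fun y => (⟨y, (sectionOf hφ he hx hxe f hf).1 y⟩ : TotalSpace F E)) =ᶠ[𝓝 x]
      fun y => e.toOpenPartialHomeomorph.symm (y, f (φ y - φ x)) := by
  filter_upwards [e.open_baseSet.eventually_mem hxe] with y hy using mk_fiberSymm hy _

theorem jet_sectionOf_eq {f g : H → F} (hf : SmoothNear 𝓘(ℝ, H) 𝓘(ℝ, V) f 0)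
    (hg : SmoothNear 𝓘(ℝ, H) 𝓘(ℝ, V) g 0) (hfg : jetMk r V f = jetMk r V g) :
    jet r (sectionOf hφ he hx hxe f hf) = jet r (sectionOf hφ he hx hxe g hg) := by
  rw [jet_eq_iff]
  refine jetEq_congr (mk_sectionOf_eventuallyEq hφ he hx hxe hf)
    (mk_sectionOf_eventuallyEq hφ he hx hxe hg) ?_
  have hsub := smoothNear_sub_chart hφ hx
  have h1 := ((jetMk_eq_iff hf hg).1 hfg).comp_right_of_eq hsub.contMDiffAt hf.contMDiffAt
    hg.contMDiffAt (sub_self (φ x))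
  have hf1 := hf.comp_of_eq hsub (sub_self _)
  have hg1 := hg.comp_of_eq hsub (sub_self _)
  exact ((JetEq.refl (fun y => y) x).prodMk h1 smoothNear_id.contMDiffAt smoothNear_id.contMDiffAt
    hf1.contMDiffAt hg1.contMDiffAt).comp_left (smoothNear_id.prodMk hf1).contMDiffAt
    (smoothNear_id.prodMk hg1).contMDiffAt (he.smoothNear_symm (q := (x, _)) hxe).contMDiffAt

theorem jet_sectionOf_jetCoord (s : LocalSection H V F E x) :
    jet r (sectionOf hφ he hx hxe _ (smoothNear_jetCoord hφ he hx hxe s)) = jet r s := by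
  rw [jet_eq_iff]
  refine JetEq.of_eventuallyEq ?_
  filter_upwards [e.open_baseSet.eventually_mem hxe, φ.open_source.eventually_mem hx,
    mk_sectionOf_eventuallyEq hφ he hx hxe (smoothNear_jetCoord hφ he hx hxe s)] with y hy hy' h
  rw [h, jetCoord, add_sub_cancel, φ.left_inv hy', ← mk_fiberSymm hy, fiberSymm_apply hy]

include hφ' hx'

theorem jetCoord_sectionOf_eventuallyEq {f : H → F} (hf : SmoothNear 𝓘(ℝ, H) 𝓘(ℝ, V) f 0) :
    jetCoord φ' e' x (sectionOf hφ he hx hxe f hf).1 =ᶠ[𝓝 0]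
      fun h => (e' (e.toOpenPartialHomeomorph.symm
        (φ'.symm (φ' x + h), f (φ (φ'.symm (φ' x + h)) - φ x)))).2 := by
  have h1 : Tendsto (fun h => φ'.symm (φ' x + h)) (𝓝 0) (𝓝 x) := by
    have := (smoothNear_symm_add hφ' hx').continuousAt.tendsto
    rwa [symm_add_zero hx'] at this
  filter_upwards [h1.eventually (mk_sectionOf_eventuallyEq hφ he hx hxe hf)] with h hh
  rw [jetCoord, hh]

omit hφ' hx'

theorem jetMk_jetCoord_sectionOf {f : H → F} (hf : SmoothNear 𝓘(ℝ, H) 𝓘(ℝ, V) f 0) :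
    jetMk r V (jetCoord φ e x (sectionOf hφ he hx hxe f hf).1) = jetMk r V f := by
  refine jetMk_congr hf ((jetCoord_sectionOf_eventuallyEq hφ he hφ hx hxe hx hf).trans ?_)
  have h1 : Tendsto (fun h => φ.symm (φ x + h)) (𝓝 0) (𝓝 x) := by
    have := (smoothNear_symm_add hφ hx).continuousAt.tendsto
    rwa [symm_add_zero hx] at this
  have h2 : Tendsto (fun h => φ x + h) (𝓝 0) (𝓝 (φ x)) := by
    have : ContinuousAt (fun h => φ x + h) 0 := by fun_prop
    simpa using this.tendsto
  filter_upwards [h1.eventually (e.open_baseSet.eventually_mem hxe),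
    h2.eventually (φ.open_target.eventually_mem (φ.map_source hx))] with h hh hh'
  rw [← mk_fiberSymm hh, apply_fiberSymm hh, φ.right_inv hh', add_sub_cancel_left]

end

open Classical in
/-- The jet at the origin of the representative of a section with given jet. -/
def fiberCoord (φ : OpenPartialHomeomorph M H) (e : Trivialization F (π F E)) (x : M)
    (ξ : JetFiber H V F E r x) : PointJet r H V F :=
  jetMk r V (jetCoord φ e x (exists_jet_eq ξ).choose.1)

section

variable (hφ : φ ∈ IsManifold.maximalAtlas 𝓘(ℝ, H) ∞ M) (he : IsSmoothTrivialization H V e)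
  (hφ' : φ' ∈ IsManifold.maximalAtlas 𝓘(ℝ, H) ∞ M) (he' : IsSmoothTrivialization H V e')
  (hx : x ∈ φ.source ∩ e.baseSet) (hx' : x ∈ φ'.source ∩ e'.baseSet)
include hφ he hx

theorem fiberCoord_jet (s : LocalSection H V F E x) :
    fiberCoord φ e x (jet r s) = jetMk r V (jetCoord φ e x s.1) :=
  jetMk_jetCoord_eq hφ he hx.1 hx.2 (exists_jet_eq (jet r s)).choose_spec

theorem fiberCoord_jet_sectionOf {f : H → F} (hf : SmoothNear 𝓘(ℝ, H) 𝓘(ℝ, V) f 0) :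
    fiberCoord φ e x (jet r (sectionOf hφ he hx.1 hx.2 f hf)) = jetMk r V f := by
  rw [fiberCoord_jet hφ he hx, jetMk_jetCoord_sectionOf]

theorem fiberCoord_injective :
    Function.Injective (fiberCoord φ e x : JetFiber H V F E r x → PointJet r H V F) := by
  intro ξ ζ h
  obtain ⟨s, rfl⟩ := exists_jet_eq ξ
  obtain ⟨t, rfl⟩ := exists_jet_eq ζ
  rw [fiberCoord_jet hφ he hx, fiberCoord_jet hφ he hx] at h
  rw [← jet_sectionOf_jetCoord hφ he hx.1 hx.2 s, ← jet_sectionOf_jetCoord hφ he hx.1 hx.2 t]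
  exact jet_sectionOf_eq hφ he hx.1 hx.2 _ _ h

theorem fiberCoord_surjective :
    Function.Surjective (fiberCoord φ e x : JetFiber H V F E r x → PointJet r H V F) := by
  intro j
  obtain ⟨f, hf, rfl⟩ := j.exists_rep
  exact ⟨_, fiberCoord_jet_sectionOf hφ he hx hf⟩

end

variable [IsManifold 𝓘(ℝ, H) ∞ M]

theorem exists_fiberCoordSymm (hE : IsSmoothFiberBundle H V F E)
    (hφ : φ ∈ IsManifold.maximalAtlas 𝓘(ℝ, H) ∞ M) (he : IsSmoothTrivialization H V e) (x : M)
    (j : PointJet r H V F) : ∃ ξ : JetFiber H V F E r x,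
      x ∈ φ.source ∩ e.baseSet → fiberCoord φ e x ξ = j := by
  by_cases hx : x ∈ φ.source ∩ e.baseSet
  · obtain ⟨ξ, hξ⟩ := fiberCoord_surjective hφ he hx j
    exact ⟨ξ, fun _ => hξ⟩
  · obtain ⟨ξ, -⟩ := fiberCoord_surjective (IsManifold.chart_mem_maximalAtlas x)
      (hE.isSmoothTrivialization (trivializationAt F E x))
      ⟨mem_chart_source H x, mem_baseSet_trivializationAt F E x⟩ j
    exact ⟨ξ, fun h => absurd h hx⟩

variable [hE : Fact (IsSmoothFiberBundle H V F E)]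

variable (r) in
/-- The local trivialization of the jet bundle defined by a chart of the base and a local
trivialization, before the construction of the topology. -/
def jetPretrivialization [TopologicalSpace (PointJet r H V F)]
    (hφ : φ ∈ IsManifold.maximalAtlas 𝓘(ℝ, H) ∞ M) (he : IsSmoothTrivialization H V e) :
    Pretrivialization (PointJet r H V F) (π (PointJet r H V F) (JetFiber H V F E r)) where
  toFun p := (p.1, fiberCoord φ e p.1 p.2)
  invFun q := ⟨q.1, (exists_fiberCoordSymm hE.out hφ he q.1 q.2).choose⟩
  source := π (PointJet r H V F) (JetFiber H V F E r) ⁻¹' (φ.source ∩ e.baseSet)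
  target := (φ.source ∩ e.baseSet) ×ˢ univ
  map_source' _ hp := ⟨hp, trivial⟩
  map_target' _ hq := hq.1
  left_inv' p hp := congrArg (TotalSpace.mk p.1) (fiberCoord_injective hφ he hp
    ((exists_fiberCoordSymm hE.out hφ he p.1 _).choose_spec hp))
  right_inv' q hq := Prod.ext rfl ((exists_fiberCoordSymm hE.out hφ he q.1 _).choose_spec hq.1)
  open_target := (φ.open_source.inter e.open_baseSet).prod isOpen_univ
  baseSet := φ.source ∩ e.baseSet
  open_baseSet := φ.open_source.inter e.open_baseSet
  source_eq := rfl
  target_eq := rfl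
  proj_toFun _ _ := rfl

variable (hφ : φ ∈ IsManifold.maximalAtlas 𝓘(ℝ, H) ∞ M) (he : IsSmoothTrivialization H V e)
  (hφ' : φ' ∈ IsManifold.maximalAtlas 𝓘(ℝ, H) ∞ M) (he' : IsSmoothTrivialization H V e')

theorem jetPretrivialization_symm_jetMk [TopologicalSpace (PointJet r H V F)]
    (hx : x ∈ φ.source ∩ e.baseSet) {f : H → F} (hf : SmoothNear 𝓘(ℝ, H) 𝓘(ℝ, V) f 0) :
    (jetPretrivialization r hφ he).toPartialEquiv.symm (x, jetMk r V f) =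
      ⟨x, jet r (sectionOf hφ he hx.1 hx.2 f hf)⟩ :=
  congrArg (TotalSpace.mk x) (fiberCoord_injective hφ he hx
    (((exists_fiberCoordSymm hE.out hφ he x _).choose_spec hx).trans
      (fiberCoord_jet_sectionOf hφ he hx hf).symm))

/-- With `y = φ'⁻¹ (φ' x + h)`, the representative `f` stands for the section with coordinate `f (φ
y - φ x)` in `e` at `y`; reading that section in `e'` gives the formula. -/
theorem jetPretrivialization_change [TopologicalSpace (PointJet r H V F)]
    (hx : x ∈ φ.source ∩ e.baseSet) (hx' : x ∈ φ'.source ∩ e'.baseSet)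
    {f : H → F} (hf : SmoothNear 𝓘(ℝ, H) 𝓘(ℝ, V) f 0) :
    jetPretrivialization r hφ' he' ((jetPretrivialization r hφ he).toPartialEquiv.symm
      (x, jetMk r V f)) = (x, jetMk r V fun h => (e' (e.toOpenPartialHomeomorph.symm
        (φ'.symm (φ' x + h), f (φ (φ'.symm (φ' x + h)) - φ x)))).2) := by
  rw [jetPretrivialization_symm_jetMk hφ he hx hf]
  refine Prod.ext rfl ((fiberCoord_jet hφ' he' hx' _).trans ?_)
  have h1 := jetCoord_sectionOf_eventuallyEq (e' := e') hφ he hφ' hx.1 hx.2 hx'.1 hf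
  exact (jetMk_congr (smoothNear_jetCoord hφ' he' hx'.1 hx'.2 _) h1.symm).symm

variable [FiniteDimensional ℝ H] [FiniteDimensional ℝ V] [IsManifold 𝓘(ℝ, V) ∞ F]

/-- The coordinate changes of the jet bundle are smooth. -/
theorem contMDiffAt_jetPretrivialization_change {q : M × PointJet r H V F}
    (hx : q.1 ∈ φ.source ∩ e.baseSet) (hx' : q.1 ∈ φ'.source ∩ e'.baseSet) :
    ContMDiffAt (𝓘(ℝ, H).prod 𝓘(ℝ, JetModel r H V)) (𝓘(ℝ, H).prod 𝓘(ℝ, JetModel r H V)) ∞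
      (fun p => jetPretrivialization r hφ' he'
        ((jetPretrivialization r hφ he).toPartialEquiv.symm p)) q := by
  obtain ⟨x, j⟩ := q
  -- Inserting smooth representatives makes the coordinate change the jet, in the variable `h`, of a
  -- map smooth in `(x, j, h)` jointly.
  obtain ⟨R, hR, hR'⟩ := j.exists_smooth_rep
  let I := (𝓘(ℝ, H).prod 𝓘(ℝ, JetModel r H V)).prod 𝓘(ℝ, H)
  have b₀ : SmoothNear I 𝓘(ℝ, H) (fun p : (M × PointJet r H V F) × H => p.1.1) ((x, j), 0) :=
    smoothNear_fst.fst
  have b₁ : SmoothNear I 𝓘(ℝ, H) (fun p : (M × PointJet r H V F) × H =>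
      φ'.symm (φ' p.1.1 + p.2)) ((x, j), 0) :=
    (smoothNear_symm_of_mem_maximalAtlas hφ' (φ'.map_source hx'.1)).comp_of_eq
      (((smoothNear_of_mem_maximalAtlas hφ' hx'.1).comp_of_eq b₀ rfl).add smoothNear_snd)
      (add_zero _)
  -- At `h = 0` the base point is `x` again and the second argument of `R` is `0`, which is where
  -- `R` is known to be smooth.
  have hb₁ : φ'.symm (φ' x + 0) = x := symm_add_zero hx'.1
  have b₂ : SmoothNear I 𝓘(ℝ, H) (fun p : (M × PointJet r H V F) × H =>
      φ (φ'.symm (φ' p.1.1 + p.2)) - φ p.1.1) ((x, j), 0) :=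
    ((smoothNear_of_mem_maximalAtlas hφ hx.1).comp_of_eq b₁ hb₁).sub
      ((smoothNear_of_mem_maximalAtlas hφ hx.1).comp_of_eq b₀ rfl)
  have b₃ : SmoothNear I 𝓘(ℝ, V) (fun p : (M × PointJet r H V F) × H =>
      R (p.1.2, φ (φ'.symm (φ' p.1.1 + p.2)) - φ p.1.1)) ((x, j), 0) :=
    hR.comp_of_eq (f := fun p : (M × PointJet r H V F) × H =>
      (p.1.2, φ (φ'.symm (φ' p.1.1 + p.2)) - φ p.1.1)) (smoothNear_fst.snd.prodMk b₂)
      (by simp only [hb₁, sub_self])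
  have b₄ : SmoothNear I (𝓘(ℝ, H).prod 𝓘(ℝ, V)) (fun p : (M × PointJet r H V F) × H =>
      e.toOpenPartialHomeomorph.symm (φ'.symm (φ' p.1.1 + p.2),
        R (p.1.2, φ (φ'.symm (φ' p.1.1 + p.2)) - φ p.1.1))) ((x, j), 0) := by
    have hq : φ'.symm (φ' x + 0) ∈ e.baseSet := by rw [hb₁]; exact hx.2
    exact (he.smoothNear_symm
      (q := (φ'.symm (φ' x + 0), R (j, φ (φ'.symm (φ' x + 0)) - φ x))) hq).comp_of_eq
      (f := fun p : (M × PointJet r H V F) × H => (φ'.symm (φ' p.1.1 + p.2),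
        R (p.1.2, φ (φ'.symm (φ' p.1.1 + p.2)) - φ p.1.1))) (b₁.prodMk b₃) rfl
  have b₅ : SmoothNear I 𝓘(ℝ, V) (fun p : (M × PointJet r H V F) × H =>
      (e' (e.toOpenPartialHomeomorph.symm (φ'.symm (φ' p.1.1 + p.2),
        R (p.1.2, φ (φ'.symm (φ' p.1.1 + p.2)) - φ p.1.1)))).2) ((x, j), 0) := by
    refine ((he'.smoothNear ?_).comp_of_eq b₄ rfl).snd
    have : φ'.symm (φ' x + 0) ∈ e.baseSet := by rw [hb₁]; exact hx.2
    rw [e.proj_symm_apply' this, hb₁]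
    exact hx'.2
  refine (contMDiffAt_fst.prodMk
    (PointJet.smoothNear_jetMk (r := r) b₅).contMDiffAt).congr_of_eventuallyEq ?_
  have hU : ∀ᶠ p : M × PointJet r H V F in 𝓝 (x, j), (p.1 ∈ φ.source ∩ e.baseSet) ∧
      p.1 ∈ φ'.source ∩ e'.baseSet :=
    continuousAt_fst.eventually (((φ.open_source.inter e.open_baseSet).eventually_mem hx).and
      ((φ'.open_source.inter e'.open_baseSet).eventually_mem hx'))
  filter_upwards [hU, continuousAt_snd.eventually hR', continuousAt_snd.eventually hR.curry]
    with p ⟨hp, hp'⟩ h1 h2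
  conv_lhs => rw [← Prod.mk.eta (p := p), ← h1]
  exact jetPretrivialization_change hφ he hφ' he' hp hp' h2

instance jetFiberTopology (x : M) : TopologicalSpace (JetFiber H V F E r x) :=
  TopologicalSpace.induced (fiberCoord (chartAt H x) (trivializationAt F E x) x) inferInstance

variable (H V F E r) in
/-- The prebundle structure of the jet bundle. -/
def jetPrebundle : FiberPrebundle (PointJet r H V F) (JetFiber H V F E r) where
  -- Every chart of the maximal atlas and every smooth trivialization is admitted, in particular
  -- trivializations by group isomorphisms and those adapted to an action.
  pretrivializationAtlas := {d | ∃ (φ : OpenPartialHomeomorph M H)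
    (hφ : φ ∈ IsManifold.maximalAtlas 𝓘(ℝ, H) ∞ M) (e : Trivialization F (π F E))
    (he : IsSmoothTrivialization H V e), d = jetPretrivialization r hφ he}
  pretrivializationAt x := jetPretrivialization r (IsManifold.chart_mem_maximalAtlas x)
    (hE.out.isSmoothTrivialization (trivializationAt F E x))
  mem_base_pretrivializationAt x := ⟨mem_chart_source H x, mem_baseSet_trivializationAt F E x⟩
  pretrivialization_mem_atlas x := ⟨_, _, _, _, rfl⟩
  continuous_trivChange := by
    rintro _ ⟨φ', hφ', e', he', rfl⟩ _ ⟨φ, hφ, e, he, rfl⟩ q ⟨hq, hq'⟩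
    exact (contMDiffAt_jetPretrivialization_change hφ he hφ' he' hq.1
      hq').continuousAt.continuousWithinAt
  totalSpaceMk_isInducing x :=
    (isEmbedding_prodMkRight x).isInducing.comp ⟨rfl⟩

instance jetTotalTopology :
    TopologicalSpace (TotalSpace (PointJet r H V F) (JetFiber H V F E r)) :=
  (jetPrebundle H V F E r).totalSpaceTopology

instance jetFiberBundle : FiberBundle (PointJet r H V F) (JetFiber H V F E r) :=
  (jetPrebundle H V F E r).toFiberBundle

variable (r) in
/-- The local trivialization of the jet bundle defined by a chart of the base and a local
trivialization. -/
def jetTrivialization :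
    Trivialization (PointJet r H V F) (π (PointJet r H V F) (JetFiber H V F E r)) :=
  (jetPrebundle H V F E r).trivializationOfMemPretrivializationAtlas
    (e := jetPretrivialization r hφ he) ⟨φ, hφ, e, he, rfl⟩

instance : MemTrivializationAtlas (jetTrivialization r hφ he) :=
  ⟨⟨_, ⟨φ, hφ, e, he, rfl⟩, rfl⟩⟩

theorem jetTrivialization_jet (hx : x ∈ φ.source ∩ e.baseSet) (s : LocalSection H V F E x) :
    jetTrivialization r hφ he ⟨x, jet r s⟩ = (x, jetMk r V (jetCoord φ e x s.1)) :=
  Prod.ext rfl (fiberCoord_jet hφ he hx s)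

variable (H V F E r) in
theorem isSmoothFiberBundle_jet :
    IsSmoothFiberBundle H (JetModel r H V) (PointJet r H V F) (JetFiber H V F E r) where
  isManifold_fiber := inferInstance
  contMDiffOn_transition := by
    rintro _ _ ⟨_, ⟨φ, hφ, e, he, rfl⟩, rfl⟩ ⟨_, ⟨φ', hφ', e', he', rfl⟩, rfl⟩ q ⟨hq, hq'⟩
    exact (contMDiffAt_jetPretrivialization_change hφ he hφ' he' hq.1
      hq').contMDiffWithinAt

variable (H V F E r) in
theorem isJetBundle : IsJetBundle H V F E r (PointJet r H V F) where
  isSmoothFiberBundle := isSmoothFiberBundle_jet H V F E r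
  t2Space_fiber _ := PointJet.t2Space
  secondCountable_fiber _ := PointJet.secondCountableTopology
  jetChart := by
    intro φ hφ e he ψ hψ
    -- The required chart is the jet trivialization of `(φ, e)` followed by `φ` on the base and the
    -- jet coordinates of `ψ` on the fiber.
    have hprod : φ.prod (PointJet.chart (r := r) (H := H) ψ hψ) ∈
        IsManifold.maximalAtlas (𝓘(ℝ, H).prod 𝓘(ℝ, JetModel r H V)) ∞
          (M × PointJet r H V F) :=
      IsManifold.mem_maximalAtlas_prod hφ (PointJet.chart_mem_maximalAtlas hψ)
    refine ⟨_, (isSmoothFiberBundle_jet H V F E r).trans_mem_maximalAtlas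
      ((isSmoothFiberBundle_jet H V F E r).isSmoothTrivialization (jetTrivialization r hφ he))
      hprod, fun x s => ?_⟩
    have hsrc : ∀ hx : x ∈ φ.source ∩ e.baseSet, jetTrivialization r hφ he ⟨x, jet r s⟩ ∈
        (φ.prod (PointJet.chart (r := r) (H := H) ψ hψ)).source ↔
        (e ⟨x, s.1 x⟩).2 ∈ ψ.source := by
      intro hx
      rw [jetTrivialization_jet hφ he hx, OpenPartialHomeomorph.prod_source, Set.mem_prod,
        PointJet.mem_chart_source_iff, PointJet.val_jetMk, jetCoord_zero hx.1]
      exact and_iff_right hx.1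
    have hiff : (⟨x, jet r s⟩ : TotalSpace (PointJet r H V F) (JetFiber H V F E r)) ∈
        ((jetTrivialization r hφ he).toOpenPartialHomeomorph.trans
          (φ.prod (PointJet.chart (r := r) (H := H) ψ hψ))).source ↔
        x ∈ φ.source ∧ x ∈ e.baseSet ∧ (e ⟨x, s.1 x⟩).2 ∈ ψ.source := by
      constructor
      · rintro ⟨hx, hx'⟩
        exact ⟨hx.1, hx.2, (hsrc hx).1 hx'⟩
      · rintro ⟨hx, hx', h⟩
        exact ⟨⟨hx, hx'⟩, (hsrc ⟨hx, hx'⟩).2 h⟩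
    refine ⟨hiff, fun h => ?_⟩
    obtain ⟨hx, hxe, hψx⟩ := hiff.1 h
    have hval : ((jetTrivialization r hφ he).toOpenPartialHomeomorph.trans
        (φ.prod (PointJet.chart (r := r) (H := H) ψ hψ))) ⟨x, jet r s⟩ =
        (φ x, derivs r (fun h => ψ (jetCoord φ e x s.1 h)) 0) := by
      refine (congrArg (φ.prod (PointJet.chart (r := r) (H := H) ψ hψ))
        (jetTrivialization_jet hφ he ⟨hx, hxe⟩ s)).trans ?_
      refine Prod.ext rfl (PointJet.chart_jetMk hψ (smoothNear_jetCoord hφ he hx hxe s) ?_)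
      rwa [jetCoord_zero hx]
    rw [hval]
    refine ⟨rfl, fun k => ?_⟩
    have hsm : SmoothNear 𝓘(ℝ, H) 𝓘(ℝ, V) (fun h => ψ (jetCoord φ e x s.1 h)) 0 :=
      (smoothNear_of_mem_maximalAtlas hψ hψx).comp_of_eq (smoothNear_jetCoord hφ he hx hxe s)
        (jetCoord_zero hx _)
    rw [derivs_apply hsm.contDiffAt]
    -- The representative is translated by `φ x`, so its derivatives at `0` are those of the
    -- untranslated one at `φ x`.
    have := iteratedFDeriv_comp_add_left (𝕜 := ℝ)
      (f := fun h => ψ (e ⟨φ.symm h, s.1 (φ.symm h)⟩).2) k (φ x) 0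
    rwa [add_zero] at this

end JetCoordinates

/-! ### Lie group bundle structure and action on jet bundles. -/

section JetGroupBundles

variable {M : Type*} [TopologicalSpace M]
  {H : Type*} [NormedAddCommGroup H] [NormedSpace ℝ H] [FiniteDimensional ℝ H] [ChartedSpace H M]
  [IsManifold 𝓘(ℝ, H) ∞ M]
  {W : Type*} [NormedAddCommGroup W] [NormedSpace ℝ W] [FiniteDimensional ℝ W]
  {G : Type*} [TopologicalSpace G] [ChartedSpace W G] [Group G] [LieGroup 𝓘(ℝ, W) ∞ G]
  {𝒢 : M → Type*} [TopologicalSpace (TotalSpace G 𝒢)] [∀ x, TopologicalSpace (𝒢 x)]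
  [FiberBundle G 𝒢] [∀ x, Group (𝒢 x)]
  [hF𝒢 : Fact (IsSmoothFiberBundle H W G 𝒢)] {r : ℕ}
  {φ : OpenPartialHomeomorph M H} {e : Trivialization G (π G 𝒢)}

/-- The trivialization of the jet bundle induced by a trivialization by group isomorphisms. -/
theorem isGroupTrivialization_jetTrivialization (hG : IsLieGroupBundle H W G 𝒢)
    (hφ : φ ∈ IsManifold.maximalAtlas 𝓘(ℝ, H) ∞ M) (he : IsGroupTrivialization H W e) :
    letI := fun x => JetFiber.group hG (r := r) (x := x)
    IsGroupTrivialization H (JetModel r H W) (jetTrivialization r hφ he.1) := by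
  refine ⟨(isSmoothFiberBundle_jet H W G 𝒢 r).isSmoothTrivialization _, fun x hx i j => ?_⟩
  obtain ⟨s, rfl⟩ := Quotient.exists_rep i
  obtain ⟨t, rfl⟩ := Quotient.exists_rep j
  have hx : x ∈ φ.source ∩ e.baseSet := hx
  have hs := smoothNear_jetCoord hφ he.1 hx.1 hx.2 s
  have ht := smoothNear_jetCoord hφ he.1 hx.1 hx.2 t
  refine (congrArg Prod.snd (jetTrivialization_jet hφ he.1 hx (LocalSection.mul hG s t))).trans
    (.trans ?_ (congrArg₂ (fun a b => a.2 * b.2) (jetTrivialization_jet hφ he.1 hx s)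
      (jetTrivialization_jet hφ he.1 hx t)).symm)
  refine .trans ?_ (PointJet.jetMk_mul hs ht).symm
  refine jetMk_congr (PointJet.smoothNear_mul hs ht) ?_
  -- Jets see a whole neighborhood of `x`, so `e` must be multiplicative over all nearby points and
  -- not only at `x`.
  filter_upwards [eventually_symm_mem_baseSet hφ hx.1 hx.2] with h hh using he.2 _ hh _ _

theorem isLieGroupBundle_jet (hG : IsLieGroupBundle H W G 𝒢) :
    letI := fun x => JetFiber.group hG (r := r) (x := x)
    IsLieGroupBundle H (JetModel r H W) (PointJet r H W G) (JetFiber H W G 𝒢 r) := by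
  let := fun x => JetFiber.group hG (r := r) (x := x)
  refine isLieGroupBundle_of_locallyConstant (isSmoothFiberBundle_jet H W G 𝒢 r) fun x => ?_
  obtain ⟨e, hx, he⟩ := hG.locallyConstant x
  exact ⟨jetTrivialization r (IsManifold.chart_mem_maximalAtlas x) he.1,
    ⟨mem_chart_source H x, hx⟩, isGroupTrivialization_jetTrivialization hG _ he⟩

variable {V : Type*} [NormedAddCommGroup V] [NormedSpace ℝ V] [FiniteDimensional ℝ V]
  {F : Type*} [TopologicalSpace F] [ChartedSpace V F] [IsManifold 𝓘(ℝ, V) ∞ F]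
  {E : M → Type*} [TopologicalSpace (TotalSpace F E)] [∀ x, TopologicalSpace (E x)]
  [FiberBundle F E] [∀ x, MulAction (𝒢 x) (E x)] [hFE : Fact (IsSmoothFiberBundle H V F E)]

theorem isLieGroupBundleAction_jet (hG : IsLieGroupBundle H W G 𝒢)
    (hE : IsSmoothFiberBundle H V F E) (hact : IsLieGroupBundleAction H W G 𝒢 V F E) :
    letI := fun x => JetFiber.group hG (r := r) (x := x)
    letI := fun x => JetFiber.mulAction hG hE hact (r := r) (x := x)
    IsLieGroupBundleAction H (JetModel r H W) (PointJet r H W G) (JetFiber H W G 𝒢 r)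
      (JetModel r H V) (PointJet r H V F) (JetFiber H V F E r) := by
  let := fun x => JetFiber.group hG (r := r) (x := x)
  let := fun x => JetFiber.mulAction hG hE hact (r := r) (x := x)
  -- The fixed action of `G` on `F` becomes an instance here and induces the action of `PointJet r H
  -- W G` on `PointJet r H V F` that serves as the local model.
  obtain ⟨_, _, hloc⟩ := hact.locallyConstant
  have hloc' : ∀ x : M, ∃ (d : Trivialization (PointJet r H W G)
      (π (PointJet r H W G) (JetFiber H W G 𝒢 r))) (d' : Trivialization (PointJet r H V F)
      (π (PointJet r H V F) (JetFiber H V F E r))), x ∈ d.baseSet ∩ d'.baseSet ∧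
      IsGroupTrivialization H (JetModel r H W) d ∧ IsSmoothTrivialization H (JetModel r H V) d' ∧
      ∀ y ∈ d.baseSet ∩ d'.baseSet, ∀ (g : JetFiber H W G 𝒢 r y) (v : JetFiber H V F E r y),
        (d' ⟨y, g • v⟩).2 = (d ⟨y, g⟩).2 • (d' ⟨y, v⟩).2 := by
    intro x
    obtain ⟨e, e', hx, he, he', hee'⟩ := hloc x
    have hφ := IsManifold.chart_mem_maximalAtlas (I := 𝓘(ℝ, H)) (n := ∞) x
    refine ⟨jetTrivialization r hφ he.1, jetTrivialization r hφ he',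
      ⟨⟨mem_chart_source H x, hx.1⟩, ⟨mem_chart_source H x, hx.2⟩⟩,
      isGroupTrivialization_jetTrivialization hG _ he,
      (isSmoothFiberBundle_jet H V F E r).isSmoothTrivialization _, fun y hy i j => ?_⟩
    obtain ⟨s, rfl⟩ := Quotient.exists_rep i
    obtain ⟨t, rfl⟩ := Quotient.exists_rep j
    have hy₁ : y ∈ (chartAt H x).source ∩ e.baseSet := hy.1
    have hy₂ : y ∈ (chartAt H x).source ∩ e'.baseSet := hy.2
    have hs := smoothNear_jetCoord hφ he.1 hy₁.1 hy₁.2 s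
    have ht := smoothNear_jetCoord hφ he' hy₂.1 hy₂.2 t
    refine (congrArg Prod.snd (jetTrivialization_jet hφ he' hy₂
      (LocalSection.smul hG hE hact s t))).trans
      (.trans ?_ (congrArg₂ (fun (a : M × PointJet r H W G) (b : M × PointJet r H V F) => a.2 • b.2)
        (jetTrivialization_jet hφ he.1 hy₁ s)
        (jetTrivialization_jet hφ he' hy₂ t)).symm)
    refine .trans ?_ (PointJet.jetMk_smul hs ht).symm
    refine jetMk_congr (PointJet.smoothNear_smul hs ht) ?_
    filter_upwards [eventually_symm_mem_baseSet hφ hy₁.1 hy₁.2, eventually_symm_mem_baseSet hφ hy₂.1 hy₂.2]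
      with h hh hh' using hee' _ ⟨hh, hh'⟩ _ _
  refine ⟨?_, inferInstance, inferInstance, hloc'⟩
  refine isSmoothHomFiberProd_of_locallyConstant (isSmoothFiberBundle_jet H W G 𝒢 r)
    (isSmoothFiberBundle_jet H V F E r) (isSmoothFiberBundle_jet H V F E r)
    (ContMDiffSMul.contMDiff_smul (I := 𝓘(ℝ, JetModel r H W)) (I' := 𝓘(ℝ, JetModel r H V))
      (n := ∞) (G := PointJet r H W G) (M := PointJet r H V F)) fun x => ?_
  obtain ⟨d, d', hx, hd, hd', h⟩ := hloc' x
  exact ⟨d, d', d', ⟨hx.1, hx.2, hx.2⟩, hd.1, hd', hd', fun y hy hy' _ => h y ⟨hy, hy'⟩⟩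

end JetGroupBundles

end BundleJets

end

/-! ### Assembly of the theorem. -/

set_option maxSynthPendingDepth 1

theorem mainTheorem2
    {H : Type uH} [NormedAddCommGroup H] [NormedSpace ℝ H] [FiniteDimensional ℝ H]
    {M : Type uM} [TopologicalSpace M] [ChartedSpace H M] [IsManifold 𝓘(ℝ, H) ∞ M]
    {W : Type uW} [NormedAddCommGroup W] [NormedSpace ℝ W] [FiniteDimensional ℝ W]
    {G : Type uG} [TopologicalSpace G] [ChartedSpace W G] [Group G]
    {𝒢 : M → Type u𝒢} [TopologicalSpace (TotalSpace G 𝒢)] [∀ x, TopologicalSpace (𝒢 x)]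
    [FiberBundle G 𝒢] [∀ x, Group (𝒢 x)]
    {V : Type uV} [NormedAddCommGroup V] [NormedSpace ℝ V] [FiniteDimensional ℝ V]
    {F : Type uF} [TopologicalSpace F] [ChartedSpace V F]
    {E : M → Type uE} [TopologicalSpace (TotalSpace F E)] [∀ x, TopologicalSpace (E x)]
    [FiberBundle F E] [∀ x, MulAction (𝒢 x) (E x)]
    (hG : IsLieGroupBundle H W G 𝒢) (hE : IsSmoothFiberBundle H V F E)
    (hact : IsLieGroupBundleAction H W G 𝒢 V F E) (r : ℕ) (hr : 1 ≤ r) :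
    -- typical fibers of the two jet bundles
    ∃ (JG : Type (max uH uW uG)) (_ : TopologicalSpace JG) (_ : ChartedSpace (JetModel r H W) JG)
      (_ : Group JG)
      (JF : Type (max uH uV uF)) (_ : TopologicalSpace JF) (_ : ChartedSpace (JetModel r H V) JF)
      -- topologies and fiber bundle structures of the two jet bundles
      (_ : TopologicalSpace (TotalSpace JG (JetFiber H W G 𝒢 r)))
      (_ : ∀ x, TopologicalSpace (JetFiber H W G 𝒢 r x))
      (_ : FiberBundle JG (JetFiber H W G 𝒢 r))
      (_ : TopologicalSpace (TotalSpace JF (JetFiber H V F E r)))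
      (_ : ∀ x, TopologicalSpace (JetFiber H V F E r x))
      (_ : FiberBundle JF (JetFiber H V F E r))
      -- group structure on the fibers of the first, and their action on those of the second
      (_ : ∀ x, Group (JetFiber H W G 𝒢 r x))
      (_ : ∀ x, MulAction (JetFiber H W G 𝒢 r x) (JetFiber H V F E r x)),
      IsJetBundle H W G 𝒢 r JG ∧ IsJetBundle H V F E r JF ∧
      IsLieGroupBundle H (JetModel r H W) JG (JetFiber H W G 𝒢 r) ∧
      IsLieGroupBundleAction H (JetModel r H W) JG (JetFiber H W G 𝒢 r)
        (JetModel r H V) JF (JetFiber H V F E r) ∧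
      (∀ (x : M) (g h : LocalSection H W G 𝒢 x), ∃ gh : LocalSection H W G 𝒢 x,
        (∀ y, gh.1 y = g.1 y * h.1 y) ∧ jet r g * jet r h = jet r gh) ∧
      (∀ (x : M) (g : LocalSection H W G 𝒢 x) (s : LocalSection H V F E x),
        ∃ gs : LocalSection H V F E x,
          (∀ y, gs.1 y = g.1 y • s.1 y) ∧ jet r g • jet r s = jet r gs) := by
  have := hG.lieGroup
  have := hE.isManifold_fiber
  -- Stated as `Fact`s because the topologies and bundle structures on the sets of jets are found by
  -- instance resolution.
  have : Fact (IsSmoothFiberBundle H W G 𝒢) := ⟨hG.isSmoothFiberBundle⟩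
  have : Fact (IsSmoothFiberBundle H V F E) := ⟨hE⟩
  have : IsManifold 𝓘(ℝ, W) ∞ G := hG.isSmoothFiberBundle.isManifold_fiber
  set_option maxSynthPendingDepth 3 in
  exact ⟨PointJet r H W G, inferInstance, inferInstance, inferInstance,
    PointJet r H V F, inferInstance, inferInstance, inferInstance, inferInstance, inferInstance,
    inferInstance, inferInstance, inferInstance, fun x => JetFiber.group hG,
    fun x => JetFiber.mulAction hG hE hact, isJetBundle H W G 𝒢 r, isJetBundle H V F E r,
    isLieGroupBundle_jet hG, isLieGroupBundleAction_jet hG hE hact,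
    fun x g h => ⟨LocalSection.mul hG g h, fun _ => rfl, rfl⟩,
    fun x g s => ⟨LocalSection.smul hG hE hact g s, fun _ => rfl, rfl⟩⟩
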